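/- Let $K$ be an infinite field of characteristic different from $2$ (characteristic $0$ allowed), let $q$ be a prime, and assume that $K$ contains a primitive $q$-th root of unity $\varepsilon$. Let $G=\mathbb{Z}_q\times\mathbb{Z}_q$ and let $L=sl_q(K)$ carry the Pauli $G$-grading: $L_{(0,0)}=0$ and $L_{(i,j)}=K\,A^iB^j$ for $(i,j)\ne(0,0)$, where $A=\mathrm{diag}(\varepsilon^{q-1},\varepsilon^{q-2},\dots,1)$ and $B=E_{12}+E_{23}+\dots+E_{q-1,q}+E_{q1}$. Let $L\langle X_G\rangle$ be the free Lie algebra over $K$ on the variables $x_i^g$ ($g\in G$, $i\in\mathbb{N}$), graded by giving $x_i^g$ degree $g$. Let $T_G(L)$ be the set of graded identities of $L$, that is, of all $f\in L\langle X_G\rangle$ that vanish whenever each variable $x_i^g$ is replaced by an arbitrary element of $L_g$. A $T_G$-ideal is an ideal of $L\langle X_G\rangle$ invariant under all its endomorphisms as a graded Lie algebra. Commutators are left-normed: $[a,b,c]=[[a,b],c]$, and so on. For $g\in G$ put $C(g)=\{h\in G : [L_g,L_h]=0\}$, and put $\mathrm{supp}\,L=\{g\in G: L_g\neq 0\}$.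 Then: (a) For all $g,h,k\in G$ with $[x_1^g,x_2^h,x_3^k]\notin T_G(L)$ there is a unique $\lambda_{g,h,k}\in K$ such that $[x_1^g,x_3^k,x_2^h]-\lambda_{g,h,k}[x_1^g,x_2^h,x_3^k]\in T_G(L)$. (b) For all $\mathbf g=(g_1,g_2,g_3,g_4)\in G^4$ such that, with $x_i=x_i^{g_i}$, neither $[x_4,x_1,x_2,x_3]$ nor $[x_4,x_3,x_2,x_1]$ lies in $T_G(L)$, there is a unique $\lambda_{\mathbf g}\in K$ such that $[x_4,x_1,x_2,x_3]-\lambda_{\mathbf g}[x_4,x_3,x_2,x_1]\in T_G(L)$, and $\lambda_{\mathbf g}\neq0$. (c) The following polynomials form a basis of the graded identities of $L$, that is, the smallest $T_G$-ideal of $L\langle X_G\rangle$ containing them is equal to $T_G(L)$: 1. $x_1^g$, for $g\notin\mathrm{supp}\,L$; 2. $[x_1^g,x_2^h]$, for $g\in G$ and $h\in C(g)$ with $g+h\in\mathrm{supp}\,L$; 3. $[x_1^g,x_3^k,x_2^h]-\lambda_{g,h,k}[x_1^g,x_2^h,x_3^k]$, for all $g,h,k\in G$ as in (a); 4. $[x_4,x_1,x_2,x_3]-\lambda_{\mathbf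 g}[x_4,x_3,x_2,x_1]$ with $x_i=x_i^{g_i}$, for all $\mathbf g\in G^4$ as in (b). -/

import Mathlib

/-! ## Graded identities of graded Lie algebras -/

noncomputable section GradedIdentities

universe u v w

variable (K : Type u) [Field K] (G : Type v) [AddCommGroup G]

/-- The free `G`-graded Lie algebra `L⟨X_G⟩`: the free Lie algebra on the variables `x_i^g`,
where `(g, i)` stands for `x_i^g`. -/
abbrev FreeGradedLie : Type _ := FreeLieAlgebra K (G × ℕ)

variable {G}

/-- The variable `x_i^g`. -/
def gvar (i : ℕ) (g : G) : FreeGradedLie K G := FreeLieAlgebra.of K (g, i)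

variable {K}

/-- `IsGradedMonomial f g`: the element `f` is a (nonassociative Lie) monomial in the variables
and the degrees of its variables add up to `g`. -/
inductive IsGradedMonomial : FreeGradedLie K G → G → Prop
  | var (i : ℕ) (g : G) : IsGradedMonomial (gvar K i g) g
  | bracket {a b : FreeGradedLie K G} {g h : G} :
      IsGradedMonomial a g → IsGradedMonomial b h → IsGradedMonomial ⁅a, b⁆ (g + h)

variable (K)

/-- The homogeneous component of degree `g` of `L⟨X_G⟩`. -/
def freeComponent (g : G) : Submodule K (FreeGradedLie K G) :=
  Submodule.span K {f | IsGradedMonomial f g}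

variable {K}

/-- An endomorphism of `L⟨X_G⟩` as a graded algebra. -/
def IsGradedEnd (φ : FreeGradedLie K G →ₗ⁅K⁆ FreeGradedLie K G) : Prop :=
  ∀ g : G, ∀ f ∈ freeComponent K g, φ f ∈ freeComponent K g

/-- A `T_G`-ideal: an ideal of `L⟨X_G⟩` invariant under all graded endomorphisms. -/
def IsTIdeal (I : LieIdeal K (FreeGradedLie K G)) : Prop :=
  ∀ φ : FreeGradedLie K G →ₗ⁅K⁆ FreeGradedLie K G, IsGradedEnd φ → ∀ f ∈ I, φ f ∈ I

/-- The `T_G`-ideal `⟨S⟩_G` generated by `S`: the intersection of all `T_G`-ideals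
containing `S`. -/
def tIdealSpan (S : Set (FreeGradedLie K G)) : LieIdeal K (FreeGradedLie K G) :=
  sInf {I | IsTIdeal I ∧ S ⊆ (I : Set (FreeGradedLie K G))}

variable {L : Type w} [LieRing L] [LieAlgebra K L]

/-- The set `T_G(L)` of graded identities of `L`, where `Γ g` is the homogeneous component of
degree `g` of `L`: those `f` that vanish under all admissible substitutions. -/
def gradedIdentities (Γ : G → Submodule K L) : Set (FreeGradedLie K G) :=
  {f | ∀ a : G × ℕ → L, (∀ g i, a (g, i) ∈ Γ g) → FreeLieAlgebra.lift K a f = 0}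

/-- The support of the grading. -/
def gradingSupport (Γ : G → Submodule K L) : Set G := {g | Γ g ≠ ⊥}

/-- `C(g)`: those `h` with `[L_g, L_h] = 0`. -/
def gradingCentralizer (Γ : G → Submodule K L) (g : G) : Set G :=
  {h | ∀ a ∈ Γ g, ∀ b ∈ Γ h, ⁅a, b⁆ = 0}

variable (K)

/-- The left-normed commutator `[x_i^g, x_j^h, x_k^l]`. -/
def comm3 (i : ℕ) (g : G) (j : ℕ) (h : G) (k : ℕ) (l : G) : FreeGradedLie K G :=
  ⁅⁅gvar K i g, gvar K j h⁆, gvar K k l⁆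

/-- The left-normed commutator `[x_i^g, x_j^h, x_k^l, x_m^r]`. -/
def comm4 (i : ℕ) (g : G) (j : ℕ) (h : G) (k : ℕ) (l : G) (m : ℕ) (r : G) : FreeGradedLie K G :=
  ⁅⁅⁅gvar K i g, gvar K j h⁆, gvar K k l⁆, gvar K m r⁆

variable {K}

/-- The polynomial `[x_1^g, x_3^k, x_2^h] - c [x_1^g, x_2^h, x_3^k]`. -/
def cubicPoly (c : K) (g h k : G) : FreeGradedLie K G :=
  comm3 K 1 g 3 k 2 h - c • comm3 K 1 g 2 h 3 k

/-- The polynomial `[x_4, x_1, x_2, x_3] - c [x_4, x_3, x_2, x_1]` where `x_i` has degree `g_i`. -/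
def quarticPoly (c : K) (g₁ g₂ g₃ g₄ : G) : FreeGradedLie K G :=
  comm4 K 4 g₄ 1 g₁ 2 g₂ 3 g₃ - c • comm4 K 4 g₄ 3 g₃ 2 g₂ 1 g₁

/-- The variables `x_1^g` with `g` outside the support. -/
def basisOne (Γ : G → Submodule K L) : Set (FreeGradedLie K G) :=
  {f | ∃ g : G, g ∉ gradingSupport Γ ∧ f = gvar K 1 g}

/-- The commutators `[x_1^g, x_2^h]` with `h ∈ C(g)` and `g + h` in the support. -/
def basisTwo (Γ : G → Submodule K L) : Set (FreeGradedLie K G) :=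
  {f | ∃ g h : G, h ∈ gradingCentralizer Γ g ∧ g + h ∈ gradingSupport Γ ∧
    f = ⁅gvar K 1 g, gvar K 2 h⁆}

/-- The condition that `[x_1^g, x_2^h, x_3^k]` is not a graded identity of `L`. -/
def CubicAdmissible (Γ : G → Submodule K L) (g h k : G) : Prop :=
  comm3 K 1 g 2 h 3 k ∉ gradedIdentities Γ

/-- The condition that neither `[x_4, x_1, x_2, x_3]` nor `[x_4, x_3, x_2, x_1]` is a graded
identity of `L`, where `x_i` has degree `g_i`. -/
def QuarticAdmissible (Γ : G → Submodule K L) (g₁ g₂ g₃ g₄ : G) : Prop :=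
  comm4 K 4 g₄ 1 g₁ 2 g₂ 3 g₃ ∉ gradedIdentities Γ ∧
    comm4 K 4 g₄ 3 g₃ 2 g₂ 1 g₁ ∉ gradedIdentities Γ

/-- The polynomials `[x_1^g, x_3^k, x_2^h] - λ_{g,h,k} [x_1^g, x_2^h, x_3^k]`, one for each
triple such that `[x_1^g, x_2^h, x_3^k]` is not a graded identity. -/
def basisThree (Γ : G → Submodule K L) (lam : G → G → G → K) : Set (FreeGradedLie K G) :=
  {f | ∃ g h k : G, CubicAdmissible Γ g h k ∧ f = cubicPoly (lam g h k) g h k}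

/-- The polynomials `[x_4, x_1, x_2, x_3] - λ [x_4, x_3, x_2, x_1]`, one for each choice of the
degrees of the variables such that neither monomial is a graded identity. -/
def basisFour (Γ : G → Submodule K L) (lam : G → G → G → G → K) : Set (FreeGradedLie K G) :=
  {f | ∃ g₁ g₂ g₃ g₄ : G, QuarticAdmissible Γ g₁ g₂ g₃ g₄ ∧
    f = quarticPoly (lam g₁ g₂ g₃ g₄) g₁ g₂ g₃ g₄}

end GradedIdentities

/-! ## The Pauli grading on `sl_m(K)` -/

noncomputable section Pauli

universe u

variable {K : Type u} [Field K]

/-- The diagonal matrix `A = diag(ε^{m-1}, ε^{m-2}, …, 1)`. -/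
def pauliA (m : ℕ) (ε : K) : Matrix (Fin m) (Fin m) K :=
  Matrix.diagonal fun i => ε ^ (m - 1 - (i : ℕ))

/-- The cyclic permutation matrix `B`, with ones at the positions `(i, i + 1)` (indices
modulo `m`). -/
def pauliB (m : ℕ) : Matrix (Fin m) (Fin m) K :=
  Matrix.of fun i j => if (j : ℕ) = ((i : ℕ) + 1) % m then 1 else 0

/-- The homogeneous components of the Pauli grading on `sl_m(K)` by `ℤ_m × ℤ_m`: the component
of degree `(0, 0)` is zero and that of degree `(i, j) ≠ (0, 0)` is `K (A^i B^j)`. -/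
def pauliComponent (m : ℕ) (ε : K) (g : ZMod m × ZMod m) :
    Submodule K (LieAlgebra.SpecialLinear.sl (Fin m) K) :=
  if g = 0 then ⊥
  else (Submodule.span K {pauliA m ε ^ g.1.val * pauliB m ^ g.2.val}).comap
    (LieAlgebra.SpecialLinear.sl (Fin m) K).subtype

end Pauli

/-! Since `q` is prime, `G` is a plane over the field `ZMod q`. Each component with `g ≠ 0` is a
line `K u_g`, and `[u_g, u_h] = c(g, h) u_{g+h}`, where `c(g, h)` vanishes exactly when `g` and `h`
are linearly dependent, that is, when the symplectic form vanishes on them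
(`isPauliBasis_pauliElement`). Evaluating at multiples of the `u_g` gives the scalars `λ` as
quotients of products of structure constants. This settles (a), (b) and the inclusion of the
generated ideal in `T_G(L)`.

For the converse, let `I` be a `T_G`-ideal containing the four families. Families 1 and 2 put into
`I` every monomial that somewhere brackets two factors of dependent degrees. Call a product
admissible if its factors have independent degrees. Dividing brackets in the quotient by `c(g, h)`
gives a commutative product, for which families 3 and 4 read `xyz = xzy` and `wxyz = wzyx` whenever
all products involved are admissible (`isSympMagma`). The heart is `mergeResults_subsingleton`:
multiplying a multiset together by admissible products always gives the same result. So modulo `I` a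
monomial is an explicit scalar times an element determined by its multiset of variables, and `f` is
governed by a commutative polynomial `P` (`exists_polynomial`) that also determines all evaluations
of `f`. If `f` is an identity, then, `K` being infinite, the coefficients of `P` in nonzero degrees
vanish. Degree zero lies in `I`, so `f ∈ I`.

Uniqueness of merging is by strong induction on the size. Let `s` be the total degree and `φ(x) =
⟨s, deg x⟩`. A multiset of at least two elements can be merged iff its degrees are nonzero and some
`φ(x) ≠ 0` (`MergesTo.mergeable`, `Mergeable.nonempty`). By induction, two first merges agree as
soon as they have a common later stage that can be merged. When the obvious common stage cannot be,
a detour through other first merges is found. Four elements are the delicate case, and the only one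
that uses `wxyz = wzyx`. -/

/-! ### Linear dependence in the plane via the symplectic form. -/

section SympForm

variable {k : Type*} [Field k]

/-- The standard symplectic form on the plane. -/
def sympForm (x y : k × k) : k := x.1 * y.2 - x.2 * y.1

theorem sympForm_self (x : k × k) : sympForm x x = 0 := by
  simp [sympForm]; ring

theorem sympForm_swap (x y : k × k) : sympForm y x = -sympForm x y := by
  simp [sympForm]; ring

theorem sympForm_add_left (x y z : k × k) :
    sympForm (x + y) z = sympForm x z + sympForm y z := by
  simp [sympForm]; ring

theorem sympForm_add_right (x y z : k × k) :
    sympForm x (y + z) = sympForm x y + sympForm x z := by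
  simp [sympForm]; ring

theorem sympForm_zero_left (x : k × k) : sympForm 0 x = 0 := by simp [sympForm]

theorem sympForm_zero_right (x : k × k) : sympForm x 0 = 0 := by simp [sympForm]

/-- Besides skew-symmetry, this is the only property of the plane that the four-element analysis
uses. -/
theorem sympForm_pluecker (x y z w : k × k) :
    sympForm x y * sympForm z w - sympForm x z * sympForm y w + sympForm x w * sympForm y z = 0 := by
  simp [sympForm]; ring

theorem sympForm_eq_zero_trans {x y z : k × k} (hy : y ≠ 0) (h₁ : sympForm x y = 0)
    (h₂ : sympForm y z = 0) : sympForm x z = 0 := by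
  simp only [sympForm] at *
  by_cases h : y.1 = 0
  · have h' : y.2 ≠ 0 := fun h' => hy (Prod.ext h h')
    apply mul_left_cancel₀ h'
    linear_combination z.2 * h₁ + x.2 * h₂
  · apply mul_left_cancel₀ h
    linear_combination z.1 * h₁ + x.1 * h₂

theorem sympForm_sum_right {H : Type*} (f : H → k × k) (x : k × k) (S : Multiset H) :
    sympForm x (S.map f).sum = (S.map fun a => sympForm x (f a)).sum := by
  induction S using Multiset.induction with
  | empty => simp [sympForm_zero_right]
  | cons a S ih => simp [sympForm_add_right, ih]

theorem sum_sympForm_eq_zero {H : Type*} (deg : H → k × k) (S : Multiset H) :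
    (S.map fun a => sympForm (S.map deg).sum (deg a)).sum = 0 := by
  rw [← sympForm_sum_right, sympForm_self]

/-- The values `φ(x)` add up to `⟨s, s⟩ = 0`, so there cannot be exactly one nonzero value. -/
theorem exists_ne_of_mem {H : Type*} {deg : H → k × k} {S T : Multiset H} {a : H} (hS : S = a ::ₘ T)
    (ha : sympForm (S.map deg).sum (deg a) ≠ 0) :
    ∃ b ∈ T, sympForm (S.map deg).sum (deg b) ≠ 0 := by
  by_contra! hT
  have h := sum_sympForm_eq_zero deg S
  generalize (S.map deg).sum = s at *
  subst hS
  rw [Multiset.map_cons, Multiset.sum_cons, Multiset.sum_eq_zero (s := T.map _), add_zero] at h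
  · exact ha h
  · intro x hx
    obtain ⟨b, hb, rfl⟩ := Multiset.mem_map.mp hx
    exact hT b hb

theorem exists_sympForm_ne {H : Type*} {deg : H → k × k} {S T : Multiset H} {a : H} (hS : S = a ::ₘ T)
    (ha : sympForm (S.map deg).sum (deg a) ≠ 0) :
    ∃ b ∈ T, sympForm (deg a) (deg b) ≠ 0 := by
  by_contra! hT
  apply ha
  rw [sympForm_swap, hS, Multiset.map_cons, Multiset.sum_cons, sympForm_add_right, sympForm_self,
    sympForm_sum_right, Multiset.sum_eq_zero]
  · simp
  · intro x hx
    obtain ⟨b, hb, rfl⟩ := Multiset.mem_map.mp hx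
    exact hT b hb

end SympForm

/-! ### Merging multisets: when a result exists. -/

section Merging

variable {k : Type*} [Field k] {H : Type*} [Mul H]

/-- A commutative multiplication, graded by the plane, which satisfies two exchange laws as far as
all products involved are products of elements with linearly independent degrees. -/
structure IsSympMagma (deg : H → k × k) : Prop where
  comm : ∀ x y : H, x * y = y * x
  deg_mul : ∀ x y : H, deg (x * y) = deg x + deg y
  cubic : ∀ x y z : H, sympForm (deg x) (deg y) ≠ 0 → sympForm (deg x + deg y) (deg z) ≠ 0 →
    sympForm (deg x) (deg z) ≠ 0 → sympForm (deg x + deg z) (deg y) ≠ 0 →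
    x * y * z = x * z * y
  quartic : ∀ w x y z : H, sympForm (deg w) (deg x) ≠ 0 → sympForm (deg w + deg x) (deg y) ≠ 0 →
    sympForm (deg w + deg x + deg y) (deg z) ≠ 0 → sympForm (deg w) (deg z) ≠ 0 →
    sympForm (deg w + deg z) (deg y) ≠ 0 → sympForm (deg w + deg z + deg y) (deg x) ≠ 0 →
    w * x * y * z = w * z * y * x

/-- `MergesTo deg S v`: one can multiply the elements of `S` together, in some order and with
some bracketing, so that the result is `v` and only elements of linearly independent degrees are
ever multiplied. -/
inductive MergesTo (deg : H → k × k) : Multiset H → H → Prop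
  | single (a : H) : MergesTo deg {a} a
  | merge (a b : H) (R : Multiset H) (v : H) : sympForm (deg a) (deg b) ≠ 0 →
      MergesTo deg ((a * b) ::ₘ R) v → MergesTo deg (a ::ₘ b ::ₘ R) v

/-- The set of all results of merging `S`. -/
def mergeResults (deg : H → k × k) (S : Multiset H) : Set H := {v | MergesTo deg S v}

/-- The condition on the degrees for a multiset with at least two elements to be mergeable. -/
def Mergeable (deg : H → k × k) (S : Multiset H) : Prop :=
  (∀ a ∈ S, deg a ≠ 0) ∧ ∃ a ∈ S, sympForm (S.map deg).sum (deg a) ≠ 0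

theorem ne_zero_left {x y : k × k} (h : sympForm x y ≠ 0) : x ≠ 0 := by
  rintro rfl; exact h (sympForm_zero_left y)

theorem ne_zero_right {x y : k × k} (h : sympForm x y ≠ 0) : y ≠ 0 := by
  rintro rfl; exact h (sympForm_zero_right x)

theorem add_ne_zero_of_sympForm {x y : k × k} (h : sympForm x y ≠ 0) : x + y ≠ 0 := by
  intro h'
  apply h
  have := sympForm_add_right x x y
  rw [h', sympForm_zero_right, sympForm_self] at this
  simpa using this.symm

variable {deg : H → k × k}

theorem MergesTo.substitute {S R : Multiset H} {v r : H} (h : MergesTo deg S v)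
    (hr : MergesTo deg (v ::ₘ R) r) : MergesTo deg (S + R) r := by
  induction h with
  | single a => simpa using hr
  | merge a b T v hab _ ih =>
    have := ih hr
    simp only [Multiset.cons_add] at this ⊢
    exact .merge a b _ r hab this

theorem MergesTo.mul {S T : Multiset H} {v w : H} (hv : MergesTo deg S v)
    (hw : MergesTo deg T w) (h : sympForm (deg v) (deg w) ≠ 0) :
    MergesTo deg (S + T) (v * w) := by
  have h0 : MergesTo deg (v ::ₘ {w}) (v * w) := .merge v w 0 _ h (.single _)
  have h1 := hv.substitute h0
  rw [add_comm, Multiset.singleton_add] at h1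
  have h2 := hw.substitute h1
  rwa [add_comm] at h2

/-- Merging preserves `s`, and `φ(ab) = φ(a) + φ(b)`. -/
theorem Mergeable.of_cons (hd : IsSympMagma deg) {a b : H} {R : Multiset H}
    (hab : sympForm (deg a) (deg b) ≠ 0) (h : Mergeable deg ((a * b) ::ₘ R)) :
    Mergeable deg (a ::ₘ b ::ₘ R) := by
  obtain ⟨h1, x, hx, hx'⟩ := h
  have hs : (((a * b) ::ₘ R).map deg).sum = ((a ::ₘ b ::ₘ R).map deg).sum := by
    simp [hd.deg_mul, add_assoc]
  rw [hs] at hx'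
  refine ⟨?_, ?_⟩
  · intro y hy
    simp only [Multiset.mem_cons] at hy
    rcases hy with rfl | rfl | hy
    · exact ne_zero_left hab
    · exact ne_zero_right hab
    · exact h1 y (by simp [hy])
  · simp only [Multiset.mem_cons] at hx
    rcases hx with rfl | hx
    · rw [hd.deg_mul, sympForm_add_right] at hx'
      by_cases ha : sympForm ((a ::ₘ b ::ₘ R).map deg).sum (deg a) = 0
      · exact ⟨b, by simp, by rwa [ha, zero_add] at hx'⟩
      · exact ⟨a, by simp, ha⟩
    · exact ⟨x, by simp [hx], hx'⟩

theorem MergesTo.mergeable (hd : IsSympMagma deg) {S : Multiset H} {v : H}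
    (h : MergesTo deg S v) : 2 ≤ S.card → Mergeable deg S := by
  induction h with
  | single a => simp
  | merge a b R v hab hm ih =>
    intro _
    by_cases hR : R = 0
    · subst hR
      refine ⟨?_, a, by simp, ?_⟩
      · intro y hy
        simp only [Multiset.mem_cons, Multiset.notMem_zero, or_false] at hy
        rcases hy with rfl | rfl
        · exact ne_zero_left hab
        · exact ne_zero_right hab
      · simp only [Multiset.map_cons, Multiset.map_zero, Multiset.sum_cons, Multiset.sum_zero,
          add_zero, sympForm_add_left, sympForm_self, zero_add]
        rw [sympForm_swap]
        exact neg_ne_zero.mpr hab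
    · refine Mergeable.of_cons hd hab (ih ?_)
      have := Multiset.card_pos.mpr hR
      simp only [Multiset.card_cons]
      omega

theorem MergesTo.deg_eq (hd : IsSympMagma deg) {S : Multiset H} {v : H}
    (h : MergesTo deg S v) : deg v = (S.map deg).sum := by
  induction h with
  | single a => simp
  | merge a b R v _ _ ih => rw [ih]; simp [hd.deg_mul, add_assoc]

/-- It is enough to merge an independent pair while some third element with `φ ≠ 0` is left alone
(`key`). At least two elements `a`, `b` have `φ ≠ 0`. Which pair to merge depends on how a third
element `c` lies relative to `a`. -/
theorem Mergeable.exists_merge (hd : IsSympMagma deg) {S : Multiset H} (h : Mergeable deg S)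
    (hc : 3 ≤ S.card) : ∃ a b R, S = a ::ₘ b ::ₘ R ∧ sympForm (deg a) (deg b) ≠ 0 ∧
      Mergeable deg ((a * b) ::ₘ R) := by
  obtain ⟨h0, a, ha, hφa⟩ := h
  have key : ∀ x y w T, S = x ::ₘ y ::ₘ w ::ₘ T → sympForm (deg x) (deg y) ≠ 0 →
      sympForm (S.map deg).sum (deg w) ≠ 0 → ∃ a b R, S = a ::ₘ b ::ₘ R ∧
      sympForm (deg a) (deg b) ≠ 0 ∧ Mergeable deg ((a * b) ::ₘ R) := by
    rintro x y w T rfl hxy hw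
    refine ⟨x, y, w ::ₘ T, rfl, hxy, ?_, w, by simp, ?_⟩
    · intro z hz
      simp only [Multiset.mem_cons] at hz
      rcases hz with rfl | hz
      · rw [hd.deg_mul]; exact add_ne_zero_of_sympForm hxy
      · exact h0 z (by simp only [Multiset.mem_cons]; tauto)
    · simpa [hd.deg_mul, add_assoc] using hw
  obtain ⟨T, hT⟩ := Multiset.exists_cons_of_mem ha
  obtain ⟨b, hb, hφb⟩ := exists_ne_of_mem hT hφa
  obtain ⟨T', hT'⟩ := Multiset.exists_cons_of_mem hb
  subst hT'
  have : 0 < T'.card := by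
    rw [hT] at hc
    simp only [Multiset.card_cons] at hc
    omega
  obtain ⟨c, hcT⟩ := Multiset.card_pos_iff_exists_mem.mp this
  obtain ⟨W, hW⟩ := Multiset.exists_cons_of_mem hcT
  by_cases hac : sympForm (deg a) (deg c) = 0
  -- Here `c` is parallel to `a`, but some `x` is not: merge `x` with `c` if `x` is `b`, and with
  -- `a` otherwise.
  · obtain ⟨x, hx, hax⟩ := exists_sympForm_ne hT hφa
    simp only [hW, Multiset.mem_cons] at hx
    have hc0 : deg c ≠ 0 := h0 c (by rw [hT, hW]; simp)
    have ha0 : deg a ≠ 0 := h0 a (by rw [hT, hW]; simp)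
    rcases hx with rfl | rfl | hx
    · by_cases hxc : sympForm (deg x) (deg c) = 0
      · refine absurd (sympForm_eq_zero_trans hc0 hac ?_) hax
        rw [sympForm_swap, hxc, neg_zero]
      · exact key x c a W (by rw [hT, hW]; simp only [← Multiset.singleton_add]; abel) hxc hφa
    · exact absurd hac hax
    · obtain ⟨W', rfl⟩ := Multiset.exists_cons_of_mem hx
      exact key a x b (c ::ₘ W') (by rw [hT, hW]; simp only [← Multiset.singleton_add]; abel)
        hax hφb
  · exact key a c b W (by rw [hT, hW]; simp only [← Multiset.singleton_add]; abel) hac hφb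

theorem Mergeable.nonempty (hd : IsSympMagma deg) : ∀ (n : ℕ) {S : Multiset H}, S.card = n + 2 →
    Mergeable deg S → (mergeResults deg S).Nonempty
  | 0, S, hc, h => by
    obtain ⟨a, b, rfl⟩ := Multiset.card_eq_two.mp hc
    refine ⟨a * b, .merge a b 0 _ ?_ (.single _)⟩
    obtain ⟨-, x, hx, hφ⟩ := h
    intro hab
    apply hφ
    have hba : sympForm (deg b) (deg a) = 0 := by rw [sympForm_swap, hab, neg_zero]
    simp only [Multiset.insert_eq_cons, Multiset.mem_cons, Multiset.mem_singleton] at hx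
    rcases hx with rfl | rfl <;> simp [sympForm_add_left, sympForm_self, hab, hba]
  | n + 1, S, hc, h => by
    obtain ⟨a, b, R, rfl, hab, hR⟩ := h.exists_merge hd (by omega)
    obtain ⟨v, hv⟩ := Mergeable.nonempty hd n (by simpa using hc) hR
    exact ⟨v, .merge a b R v hab hv⟩

end Merging

/-! ### Comparing first merges of four elements. -/

section FourElements

variable {k X α : Type*} [Field k] {B : X → X → k} {E : X → X → X → X → α}

/-- The exchange moves between the six ways of starting to merge four elements; here `E a b c d`
stands for the results obtained by multiplying `a` and `b` first. -/
structure FourExchange (B : X → X → k) (E : X → X → X → X → α) : Prop where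
  swap : ∀ x y, B y x = -B x y
  pluecker : ∀ x y z w, B x y * B z w - B x z * B y w + B x w * B y z = 0
  comm_left : ∀ a b c d, E b a c d = E a b c d
  comm_right : ∀ a b c d, E a b d c = E a b c d
  -- The common stage is `{ab, cd}`.
  disjoint : ∀ a b c d, B a b ≠ 0 → B c d ≠ 0 → B a c + B a d + B b c + B b d ≠ 0 →
    E a b c d = E c d a b
  -- The common stage is `{abc, d}`; the last condition is `φ(d) ≠ 0`.
  triple : ∀ a b c d, B a b ≠ 0 → B a c ≠ 0 → B a c + B b c ≠ 0 → B a b + B c b ≠ 0 →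
    B a d + B b d + B c d ≠ 0 → E a b c d = E a c b d
  -- This is `abdc = acdb`; the last two conditions are `φ(b) ≠ 0` and `φ(c) ≠ 0`.
  quartic : ∀ a b c d, B a b ≠ 0 → B a c ≠ 0 → B a d + B b d ≠ 0 → B a d + B c d ≠ 0 →
    B a b + B c b + B d b ≠ 0 → B a c + B b c + B d c ≠ 0 → E a b c d = E a c b d

/-- Now `(ab)c` is not admissible, so `triple` does not apply directly. The Plücker relation becomes
`B(a,b) B(c,d) = B(a,c) B(a+b,d)`, which makes `c, d` and `ab, d` independent. Then `ac` is tied to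
`bc` and `ab` to `cd`, and it remains to connect these two groups. -/
theorem FourExchange.share_of_eq_zero (h : FourExchange B E) {a b c d : X} (hab : B a b ≠ 0)
    (hac : B a c ≠ 0) (hd : B a d + B b d + B c d ≠ 0) (h0 : B a c + B b c = 0) :
    E a b c d = E a c b d := by
  have hpl := h.pluecker a b c d
  have hba := h.swap a b
  have hca := h.swap a c
  have hda := h.swap a d
  have hcb := h.swap b c
  have hdb := h.swap b d
  have hdc := h.swap c d
  have hbc : B b c = -B a c := by linear_combination h0
  have hpl' : B a b * B c d = B a c * (B a d + B b d) := by
    linear_combination hpl - B a d * h0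
  have hpq : B a b + B a c ≠ 0 := by
    intro h1
    apply hd
    apply mul_left_cancel₀ hac
    linear_combination B c d * h1 - hpl'
  have hcd : B c d ≠ 0 := by
    intro h1
    apply hd
    apply mul_left_cancel₀ hac
    linear_combination (B a b + B a c) * h1 - hpl'
  have had : B a d + B b d ≠ 0 := by
    intro h1
    rw [h1, mul_zero] at hpl'
    exact mul_ne_zero hab hcd hpl'
  have t1 : E c a b d = E c b a d := by
    apply h.triple <;> grind
  have t1' : E a c b d = E b c a d := by
    rw [← h.comm_left a c, ← h.comm_left b c]; exact t1
  have t2 : E a b c d = E c d a b := by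
    apply h.disjoint <;> grind
  -- A quartic move based at `a` or at `b` connects the groups. Where neither is available, the path
  -- leads from `cd` through `bd` or `ad`, each of which is complementary to a pair in the other
  -- group.
  by_cases hφb : B a b + B c b + B d b = 0
  · by_cases hbcd : B b d + B c d = 0
    · have t3 : E d c b a = E d b c a := by apply h.triple <;> grind
      have t4 : E b d a c = E a c b d := by apply h.disjoint <;> grind
      rw [t2, ← t4, ← h.comm_left c d, ← h.comm_right, t3, h.comm_left, h.comm_right]
    · have t3 : E b a c d = E b c a d := by apply h.quartic <;> grind
      rw [t1', ← t3, h.comm_left]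
  · by_cases hacd : B a d + B c d = 0
    · by_cases hφa : B a b + B a c + B a d = 0
      · have t3 : E d c a b = E d a c b := by apply h.triple <;> grind
        have t4 : E a d b c = E b c a d := by apply h.disjoint <;> grind
        rw [t2, t1', ← t4, ← h.comm_left c d, t3, h.comm_left, h.comm_right]
      · by_cases hbcd : B b d + B c d = 0
        · have t3 : E d c b a = E d b c a := by apply h.triple <;> grind
          have t4 : E b d a c = E a c b d := by apply h.disjoint <;> grind
          rw [t2, ← t4, ← h.comm_left c d, ← h.comm_right, t3, h.comm_left, h.comm_right]
        · have t3 : E b a c d = E b c a d := by apply h.quartic <;> grind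
          rw [t1', ← t3, h.comm_left]
    · apply h.quartic <;> grind

/-- If `φ(d) = 0`, then `d` cannot be multiplied last, and the quartic move absorbs it in the
middle. Otherwise `d` is kept for last. -/
theorem FourExchange.share (h : FourExchange B E) {a b c d : X} (hab : B a b ≠ 0)
    (hac : B a c ≠ 0) (hv₁ : B a c + B b c + B d c ≠ 0 ∨ B a d + B b d + B c d ≠ 0)
    (hv₂ : B a b + B c b + B d b ≠ 0 ∨ B a d + B b d + B c d ≠ 0)
    (hd : B a d ≠ 0 ∨ B b d ≠ 0) : E a b c d = E a c b d := by
  have hpl := h.pluecker a b c d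
  have hcb := h.swap b c
  have hdb := h.swap b d
  have hdc := h.swap c d
  by_cases hφd : B a d + B b d + B c d = 0
  · have hc := hv₁.resolve_right (not_not.mpr hφd)
    have hb := hv₂.resolve_right (not_not.mpr hφd)
    apply h.quartic _ _ _ _ hab hac _ _ hb hc
    · intro h1
      have h2 : B a d * (B a c + B b c + B d c) = 0 := by grind
      grind
    · intro h1
      have h2 : B a d * (B a b + B c b + B d b) = 0 := by grind
      grind
  · by_cases h1 : B a c + B b c = 0
    · exact h.share_of_eq_zero hab hac hφd h1
    · by_cases h2 : B a b + B c b = 0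
      · exact (h.share_of_eq_zero hac hab (by grind) h2).symm
      · exact h.triple _ _ _ _ hab hac h1 h2 hφd

/-- If `(ab)(cd)` is not admissible, the detour is through `ac`, or through `ad` when `a` and `c`
are dependent. -/
theorem FourExchange.all_disjoint (h : FourExchange B E) {a b c d : X} (hab : B a b ≠ 0)
    (hcd : B c d ≠ 0) (hv₁ : B a c + B b c + B d c ≠ 0 ∨ B a d + B b d + B c d ≠ 0)
    (hv₂ : B b a + B c a + B d a ≠ 0 ∨ B a b + B c b + B d b ≠ 0) :
    E a b c d = E c d a b := by
  have hpl := h.pluecker a b c d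
  have hba := h.swap a b
  have hca := h.swap a c
  have hda := h.swap a d
  have hcb := h.swap b c
  have hdb := h.swap b d
  have hdc := h.swap c d
  have hprod := mul_ne_zero hab hcd
  by_cases h1 : B a c + B a d + B b c + B b d = 0
  · by_cases hac : B a c = 0
    · have t1 : E a b d c = E a d b c := by apply h.share <;> grind
      have t2 : E d a c b = E d c a b := by apply h.share <;> grind
      rw [← h.comm_right, t1, ← h.comm_left, ← h.comm_right, t2, h.comm_left]
    · have t1 : E a b c d = E a c b d := by apply h.share <;> grind
      have t2 : E c a d b = E c d a b := by apply h.share <;> grind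
      rw [t1, ← h.comm_left, ← h.comm_right, t2]
  · exact h.disjoint _ _ _ _ hab hcd h1

end FourElements

/-! ### Basic exchanges of first merges under the induction hypothesis. -/

section MergeStep

variable {k : Type*} [Field k] {H : Type*} [Mul H] {deg : H → k × k}

/-- The induction hypothesis for the uniqueness of merge results, on multisets with fewer
elements than `S`. -/
def UniqueBelow (deg : H → k × k) (S : Multiset H) : Prop :=
  ∀ T : Multiset H, T.card < S.card → (mergeResults deg T).Subsingleton

theorem mergeResults_singleton (a : H) : (mergeResults deg {a}).Nonempty := ⟨a, .single a⟩

theorem mergeResults_pair {a b : H} (hab : sympForm (deg a) (deg b) ≠ 0) :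
    (mergeResults deg (a ::ₘ {b})).Nonempty := ⟨a * b, .merge a b 0 _ hab (.single _)⟩

/-- A smaller multiset has at most one result, so any branch that succeeds gives all of it. This
lets two first merges be compared through a common later stage. -/
theorem UniqueBelow.merge_eq {S T : Multiset H} {a b : H} {R : Multiset H}
    (hU : UniqueBelow deg S) (hT : T = a ::ₘ b ::ₘ R) (hc : T.card < S.card)
    (hab : sympForm (deg a) (deg b) ≠ 0) (hne : (mergeResults deg ((a * b) ::ₘ R)).Nonempty) :
    mergeResults deg T = mergeResults deg ((a * b) ::ₘ R) := by
  have hsub : mergeResults deg ((a * b) ::ₘ R) ⊆ mergeResults deg T := by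
    intro v hv
    rw [hT]
    exact MergesTo.merge a b R v hab hv
  obtain ⟨v, hv⟩ := hne
  apply Set.Subset.antisymm _ hsub
  intro w hw
  rwa [hU T hc hw (hsub hv)]

/-- The new element `ab` cannot be the only one with `φ ≠ 0`, so an untouched element has this
property too. -/
theorem exists_of_mergeResults (hd : IsSympMagma deg) {S R : Multiset H} {a b : H}
    (hS : S = a ::ₘ b ::ₘ R) (hR : R ≠ 0) (h : (mergeResults deg ((a * b) ::ₘ R)).Nonempty) :
    ∃ x ∈ R, sympForm (S.map deg).sum (deg x) ≠ 0 := by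
  obtain ⟨v, hv⟩ := h
  have hs : (((a * b) ::ₘ R).map deg).sum = (S.map deg).sum := by
    simp [hS, hd.deg_mul, add_assoc]
  have hc := Multiset.card_pos.mpr hR
  obtain ⟨-, x, hx, hφ⟩ := MergesTo.mergeable hd hv (by simp only [Multiset.card_cons]; omega)
  simp only [Multiset.mem_cons] at hx
  rcases hx with rfl | hx
  · obtain ⟨y, hy, hy'⟩ := exists_ne_of_mem rfl hφ
    exact ⟨y, hy, by rwa [hs] at hy'⟩
  · exact ⟨x, hx, by rwa [hs] at hφ⟩

theorem mergeResults_nonempty (hd : IsSympMagma deg) {T R : Multiset H} {t : k × k} {a : H}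
    (ht : (T.map deg).sum = t) (hT : T = a ::ₘ R) (h0 : ∀ x ∈ T, deg x ≠ 0)
    (hφ : ∃ x ∈ T, sympForm t (deg x) ≠ 0) : (mergeResults deg T).Nonempty := by
  subst ht
  by_cases hR : R = 0
  · subst hR
    rw [hT]
    exact mergeResults_singleton a
  · have := Multiset.card_pos.mpr hR
    exact Mergeable.nonempty hd (R.card - 1) (by rw [hT, Multiset.card_cons]; omega) ⟨h0, hφ⟩

theorem UniqueBelow.disjoint (hd : IsSympMagma deg) {S T T' W : Multiset H} {a b c d : H}
    (hU : UniqueBelow deg S) (h0 : ∀ x ∈ S, deg x ≠ 0) (hS : S = a ::ₘ b ::ₘ c ::ₘ d ::ₘ W)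
    (hT : T = c ::ₘ d ::ₘ W) (hT' : T' = a ::ₘ b ::ₘ W)
    (hab : sympForm (deg a) (deg b) ≠ 0) (hcd : sympForm (deg c) (deg d) ≠ 0)
    (hφ : (∃ x ∈ W, sympForm (S.map deg).sum (deg x) ≠ 0) ∨
      sympForm (S.map deg).sum (deg a) + sympForm (S.map deg).sum (deg b) ≠ 0) :
    mergeResults deg ((a * b) ::ₘ T) = mergeResults deg ((c * d) ::ₘ T') := by
  have hs : (((a * b) ::ₘ (c * d) ::ₘ W).map deg).sum = (S.map deg).sum := by
    rw [hS]; simp [hd.deg_mul, add_assoc]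
  have hne : (mergeResults deg ((a * b) ::ₘ (c * d) ::ₘ W)).Nonempty := by
    apply mergeResults_nonempty hd hs rfl
    · intro x hx
      simp only [Multiset.mem_cons] at hx
      rcases hx with rfl | rfl | hx
      · rw [hd.deg_mul]; exact add_ne_zero_of_sympForm hab
      · rw [hd.deg_mul]; exact add_ne_zero_of_sympForm hcd
      · exact h0 x (by rw [hS]; simp [hx])
    · rcases hφ with ⟨x, hx, hφ⟩ | hφ
      · exact ⟨x, by simp [hx], hφ⟩
      · exact ⟨a * b, by simp, by rwa [hd.deg_mul, sympForm_add_right]⟩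
  have hne' : (mergeResults deg ((c * d) ::ₘ (a * b) ::ₘ W)).Nonempty := by
    rwa [Multiset.cons_swap]
  rw [hU.merge_eq (T := (a * b) ::ₘ T) (a := c) (b := d) (R := (a * b) ::ₘ W)
      (by rw [hT]; simp only [← Multiset.singleton_add]; abel) (by rw [hS, hT]; simp) hcd hne',
    hU.merge_eq (T := (c * d) ::ₘ T') (a := a) (b := b) (R := (c * d) ::ₘ W)
      (by rw [hT']; simp only [← Multiset.singleton_add]; abel) (by rw [hS, hT']; simp) hab hne,
    Multiset.cons_swap]

theorem UniqueBelow.triple (hd : IsSympMagma deg) {S T T' W : Multiset H} {a b c : H}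
    (hU : UniqueBelow deg S) (h0 : ∀ x ∈ S, deg x ≠ 0) (hS : S = a ::ₘ b ::ₘ c ::ₘ W)
    (hT : T = c ::ₘ W) (hT' : T' = b ::ₘ W)
    (hab : sympForm (deg a) (deg b) ≠ 0) (hac : sympForm (deg a) (deg c) ≠ 0)
    (habc : sympForm (deg a) (deg c) + sympForm (deg b) (deg c) ≠ 0)
    (hacb : sympForm (deg a) (deg b) + sympForm (deg c) (deg b) ≠ 0)
    (hφ : W = 0 ∨ ∃ x ∈ W, sympForm (S.map deg).sum (deg x) ≠ 0) :
    mergeResults deg ((a * b) ::ₘ T) = mergeResults deg ((a * c) ::ₘ T') := by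
  rw [← sympForm_add_left] at habc hacb
  have hs : (((a * b * c) ::ₘ W).map deg).sum = (S.map deg).sum := by
    rw [hS]; simp [hd.deg_mul, add_assoc]
  have hne : (mergeResults deg ((a * b * c) ::ₘ W)).Nonempty := by
    rcases hφ with rfl | ⟨x, hx, hφ⟩
    · exact mergeResults_singleton _
    · apply mergeResults_nonempty hd hs rfl
      · intro x hx
        simp only [Multiset.mem_cons] at hx
        rcases hx with rfl | hx
        · rw [hd.deg_mul, hd.deg_mul]; exact add_ne_zero_of_sympForm habc
        · exact h0 x (by rw [hS]; simp [hx])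
      · exact ⟨x, by simp [hx], hφ⟩
  have heq : a * b * c = a * c * b := hd.cubic a b c hab habc hac hacb
  rw [hU.merge_eq (T := (a * b) ::ₘ T) (a := a * b) (b := c) (R := W)
      (by rw [hT]) (by rw [hS, hT]; simp) (by rwa [hd.deg_mul]) hne,
    hU.merge_eq (T := (a * c) ::ₘ T') (a := a * c) (b := b) (R := W)
      (by rw [hT']) (by rw [hS, hT']; simp) (by rwa [hd.deg_mul]) (by rwa [← heq]), heq]

theorem UniqueBelow.fourExchange (hd : IsSympMagma deg) {S : Multiset H}
    (hU : UniqueBelow deg S) (h4 : S.card = 4) :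
    FourExchange (fun a b => sympForm (deg a) (deg b))
      (fun a b c d => mergeResults deg ((a * b) ::ₘ c ::ₘ d ::ₘ 0)) where
  swap x y := sympForm_swap _ _
  pluecker x y z w := sympForm_pluecker _ _ _ _
  comm_left a b c d := by rw [hd.comm]
  comm_right a b c d := by rw [Multiset.cons_swap d c]
  disjoint a b c d hab hcd hs := by
    have hne : sympForm (deg (a * b)) (deg (c * d)) ≠ 0 := by
      rw [hd.deg_mul, hd.deg_mul]
      simpa only [sympForm_add_left, sympForm_add_right, ← add_assoc, add_right_comm] using hs
    have hne' : sympForm (deg (c * d)) (deg (a * b)) ≠ 0 := by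
      rw [sympForm_swap]; exact neg_ne_zero.mpr hne
    rw [hU.merge_eq (T := (a * b) ::ₘ c ::ₘ d ::ₘ 0) (a := c) (b := d) (R := {a * b})
        (by simp only [← Multiset.singleton_add]; abel) (by rw [h4]; simp) hcd
        (mergeResults_pair hne'),
      hU.merge_eq (T := (c * d) ::ₘ a ::ₘ b ::ₘ 0) (a := a) (b := b) (R := {c * d})
        (by simp only [← Multiset.singleton_add]; abel) (by rw [h4]; simp) hab
        (mergeResults_pair hne)]
    simp only [← Multiset.singleton_add, add_comm]
  triple a b c d hab hac habc hacb hs := by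
    simp only [← sympForm_add_left] at habc hacb hs
    have heq : a * b * c = a * c * b := hd.cubic a b c hab habc hac hacb
    have hne : (mergeResults deg ((a * b * c) ::ₘ d ::ₘ 0)).Nonempty :=
      mergeResults_pair (by rwa [hd.deg_mul, hd.deg_mul])
    rw [hU.merge_eq (T := (a * b) ::ₘ c ::ₘ d ::ₘ 0) (a := a * b) (b := c) (R := d ::ₘ 0)
        rfl (by rw [h4]; simp) (by rwa [hd.deg_mul]) hne,
      hU.merge_eq (T := (a * c) ::ₘ b ::ₘ d ::ₘ 0) (a := a * c) (b := b) (R := d ::ₘ 0)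
        rfl (by rw [h4]; simp) (by rwa [hd.deg_mul]) (by rwa [← heq]), heq]
  quartic a b c d hab hac habd hacd hb hc := by
    rw [add_right_comm] at hb hc
    simp only [← sympForm_add_left] at habd hacd hb hc
    have hb' : sympForm (deg a + deg c + deg d) (deg b) ≠ 0 := by rwa [add_right_comm]
    have hc' : sympForm (deg a + deg b + deg d) (deg c) ≠ 0 := by rwa [add_right_comm]
    have heq : a * b * d * c = a * c * d * b := hd.quartic a b d c hab habd hc' hac hacd hb'
    have hne₁ : sympForm (deg (a * b * d)) (deg c) ≠ 0 := by rwa [hd.deg_mul, hd.deg_mul]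
    have hne₂ : sympForm (deg (a * c * d)) (deg b) ≠ 0 := by rwa [hd.deg_mul, hd.deg_mul]
    rw [hU.merge_eq (T := (a * b) ::ₘ c ::ₘ d ::ₘ 0) (a := a * b) (b := d) (R := c ::ₘ 0)
        (by rw [Multiset.cons_swap d c]) (by rw [h4]; simp) (by rwa [hd.deg_mul])
        (mergeResults_pair hne₁),
      hU.merge_eq (T := (a * c) ::ₘ b ::ₘ d ::ₘ 0) (a := a * c) (b := d) (R := b ::ₘ 0)
        (by rw [Multiset.cons_swap d b]) (by rw [h4]; simp) (by rwa [hd.deg_mul])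
        (mergeResults_pair hne₂),
      hU.merge_eq (T := (a * b * d) ::ₘ c ::ₘ 0) (a := a * b * d) (b := c) (R := 0)
        rfl (by rw [h4]; simp) hne₁ (mergeResults_singleton _),
      hU.merge_eq (T := (a * c * d) ::ₘ b ::ₘ 0) (a := a * c * d) (b := b) (R := 0)
        rfl (by rw [h4]; simp) hne₂ (mergeResults_singleton _), heq]

end MergeStep

/-! ### Uniqueness of the result of merging. -/

section MergeUnique

variable {k : Type*} [Field k] {H : Type*} [Mul H] {deg : H → k × k}

theorem sympForm_ne_of_mem_line {s x z : k × k} (hz0 : z ≠ 0) (hz : sympForm s z = 0)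
    (hx : sympForm s x ≠ 0) : sympForm x z ≠ 0 := by
  intro h
  apply hx
  apply sympForm_eq_zero_trans hz0 hz
  rw [sympForm_swap, h, neg_zero]

theorem sympForm_ne_swap {x y : k × k} (h : sympForm x y ≠ 0) : sympForm y x ≠ 0 := by
  rw [sympForm_swap]; exact neg_ne_zero.mpr h

/-- The element `z` lies on the line of `s`, hence is independent of `a` and `d`. The path is `ab →
dz → bc → az → cd`, and every step leaves one of `a, b, c, d` outside both pairs, with `φ ≠ 0`. -/
theorem UniqueBelow.disjoint_of_cross (hd : IsSympMagma deg) {S T T' W : Multiset H}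
    {a b c d z : H} (hU : UniqueBelow deg S) (h0 : ∀ x ∈ S, deg x ≠ 0)
    (hS : S = a ::ₘ b ::ₘ c ::ₘ d ::ₘ z ::ₘ W)
    (hT : T = c ::ₘ d ::ₘ z ::ₘ W) (hT' : T' = a ::ₘ b ::ₘ z ::ₘ W)
    (hab : sympForm (deg a) (deg b) ≠ 0) (hcd : sympForm (deg c) (deg d) ≠ 0)
    (hbc : sympForm (deg b) (deg c) ≠ 0)
    (ha : sympForm (S.map deg).sum (deg a) ≠ 0) (hb : sympForm (S.map deg).sum (deg b) ≠ 0)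
    (hc : sympForm (S.map deg).sum (deg c) ≠ 0) (hd' : sympForm (S.map deg).sum (deg d) ≠ 0)
    (hz : sympForm (S.map deg).sum (deg z) = 0) :
    mergeResults deg ((a * b) ::ₘ T) = mergeResults deg ((c * d) ::ₘ T') := by
  have hz0 : deg z ≠ 0 := h0 z (by rw [hS]; simp)
  have hdz := sympForm_ne_of_mem_line hz0 hz hd'
  have haz := sympForm_ne_of_mem_line hz0 hz ha
  have t1 : mergeResults deg ((a * b) ::ₘ T) = mergeResults deg ((d * z) ::ₘ a ::ₘ b ::ₘ c ::ₘ W) :=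
    hU.disjoint hd h0 (W := c ::ₘ W) (by rw [hS]; simp only [← Multiset.singleton_add]; abel)
      (by rw [hT]; simp only [← Multiset.singleton_add]; abel) rfl hab hdz
      (Or.inl ⟨c, by simp, hc⟩)
  have t2 : mergeResults deg ((d * z) ::ₘ a ::ₘ b ::ₘ c ::ₘ W) =
      mergeResults deg ((b * c) ::ₘ a ::ₘ d ::ₘ z ::ₘ W) :=
    hU.disjoint hd h0 (W := a ::ₘ W) (by rw [hS]; simp only [← Multiset.singleton_add]; abel)
      (by simp only [← Multiset.singleton_add]; abel)
      (by simp only [← Multiset.singleton_add]; abel) hdz hbc (Or.inl ⟨a, by simp, ha⟩)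
  have t3 : mergeResults deg ((b * c) ::ₘ a ::ₘ d ::ₘ z ::ₘ W) =
      mergeResults deg ((a * z) ::ₘ b ::ₘ c ::ₘ d ::ₘ W) :=
    hU.disjoint hd h0 (W := d ::ₘ W) (by rw [hS]; simp only [← Multiset.singleton_add]; abel)
      (by simp only [← Multiset.singleton_add]; abel)
      (by simp only [← Multiset.singleton_add]) hbc haz (Or.inl ⟨d, by simp, hd'⟩)
  have t4 : mergeResults deg ((a * z) ::ₘ b ::ₘ c ::ₘ d ::ₘ W) =
      mergeResults deg ((c * d) ::ₘ T') :=
    hU.disjoint hd h0 (W := b ::ₘ W) (by rw [hS]; simp only [← Multiset.singleton_add]; abel)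
      (by simp only [← Multiset.singleton_add]; abel)
      (by rw [hT']; simp only [← Multiset.singleton_add]; abel) haz hcd (Or.inl ⟨b, by simp, hb⟩)
  rw [t1, t2, t3, t4]

theorem UniqueBelow.all_disjoint (hd : IsSympMagma deg) {S T T' W : Multiset H} {a b c d : H}
    (hU : UniqueBelow deg S) (h0 : ∀ x ∈ S, deg x ≠ 0) (hS : S = a ::ₘ b ::ₘ c ::ₘ d ::ₘ W)
    (hT : T = c ::ₘ d ::ₘ W) (hT' : T' = a ::ₘ b ::ₘ W)
    (hab : sympForm (deg a) (deg b) ≠ 0) (hcd : sympForm (deg c) (deg d) ≠ 0)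
    (hv₁ : ∃ x ∈ T, sympForm (S.map deg).sum (deg x) ≠ 0)
    (hv₂ : ∃ x ∈ T', sympForm (S.map deg).sum (deg x) ≠ 0) :
    mergeResults deg ((a * b) ::ₘ T) = mergeResults deg ((c * d) ::ₘ T') := by
  by_cases hW : W = 0
  · subst hW
    have h4 := hU.fourExchange hd (by rw [hS]; simp)
    have hs : (S.map deg).sum = deg a + (deg b + (deg c + deg d)) := by rw [hS]; simp
    subst hT hT'
    apply h4.all_disjoint hab hcd
    · simp only [hs, Multiset.mem_cons, Multiset.notMem_zero, or_false, exists_eq_or_imp,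
        exists_eq_left, sympForm_add_left, sympForm_self] at hv₁
      simpa [add_assoc] using hv₁
    · simp only [hs, Multiset.mem_cons, Multiset.notMem_zero, or_false, exists_eq_or_imp,
        exists_eq_left, sympForm_add_left, sympForm_self] at hv₂
      simpa [add_assoc] using hv₂
  by_cases hφ : (∃ x ∈ W, sympForm (S.map deg).sum (deg x) ≠ 0) ∨
      sympForm (S.map deg).sum (deg a) + sympForm (S.map deg).sum (deg b) ≠ 0
  · exact hU.disjoint hd h0 hS hT hT' hab hcd hφ
  -- In the remaining case all of `W` lies on the line of `s` and `φ(a) = -φ(b)`, `φ(c) = -φ(d)`,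
  -- all four nonzero.
  push Not at hφ
  obtain ⟨hφW, hφab⟩ := hφ
  obtain ⟨z, hz⟩ := Multiset.exists_mem_of_ne_zero hW
  obtain ⟨W, rfl⟩ := Multiset.exists_cons_of_mem hz
  have hφcd : sympForm (S.map deg).sum (deg c) + sympForm (S.map deg).sum (deg d) = 0 := by
    have h := sum_sympForm_eq_zero deg S
    generalize (S.map deg).sum = s at *
    rw [hS, Multiset.map_cons, Multiset.map_cons, Multiset.map_cons, Multiset.map_cons,
      Multiset.sum_cons, Multiset.sum_cons, Multiset.sum_cons, Multiset.sum_cons,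
      Multiset.sum_eq_zero (s := Multiset.map _ (z ::ₘ W))] at h
    · linear_combination h - hφab
    · intro x hx
      obtain ⟨y, hy, rfl⟩ := Multiset.mem_map.mp hx
      exact hφW y hy
  have hφz := hφW z (by simp)
  have hcd' : sympForm (S.map deg).sum (deg c) ≠ 0 ∧ sympForm (S.map deg).sum (deg d) ≠ 0 := by
    obtain ⟨x, hx, hφx⟩ := hv₁
    rw [hT, Multiset.mem_cons, Multiset.mem_cons] at hx
    rcases hx with rfl | rfl | hx
    · exact ⟨hφx, fun h => hφx (by rwa [h, add_zero] at hφcd)⟩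
    · exact ⟨fun h => hφx (by rwa [h, zero_add] at hφcd), hφx⟩
    · exact absurd (hφW x hx) hφx
  have hab' : sympForm (S.map deg).sum (deg a) ≠ 0 ∧ sympForm (S.map deg).sum (deg b) ≠ 0 := by
    obtain ⟨x, hx, hφx⟩ := hv₂
    rw [hT', Multiset.mem_cons, Multiset.mem_cons] at hx
    rcases hx with rfl | rfl | hx
    · exact ⟨hφx, fun h => hφx (by rwa [h, add_zero] at hφab)⟩
    · exact ⟨fun h => hφx (by rwa [h, zero_add] at hφab), hφx⟩
    · exact absurd (hφW x hx) hφx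
  by_cases hbc : sympForm (deg b) (deg c) = 0
  · by_cases hbd : sympForm (deg b) (deg d) = 0
    · exfalso
      have hb0 : deg b ≠ 0 := h0 b (by rw [hS]; simp)
      refine hcd (sympForm_eq_zero_trans hb0 ?_ hbd)
      rw [sympForm_swap, hbc, neg_zero]
    · rw [hd.comm c d]
      exact hU.disjoint_of_cross hd h0 (z := z) (W := W)
        (by rw [hS]; simp only [← Multiset.singleton_add]; abel)
        (by rw [hT]; simp only [← Multiset.singleton_add]; abel) hT'
        hab (sympForm_ne_swap hcd) hbd hab'.1 hab'.2 hcd'.2 hcd'.1 hφz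
  · exact hU.disjoint_of_cross hd h0 hS hT hT' hab hcd hbc hab'.1 hab'.2 hcd'.1 hcd'.2 hφz

/-- Here `(ab)c` is not admissible. An independent pair `x, y` in `W` gives the path `ab → xy → ac`.
Otherwise `W` lies on one line, and two of its elements `d, e` serve as partners for `a, b, c`. -/
theorem UniqueBelow.share_of_eq_zero (hd : IsSympMagma deg) {S W : Multiset H} {a b c : H}
    (hU : UniqueBelow deg S) (h0 : ∀ x ∈ S, deg x ≠ 0) (hS : S = a ::ₘ b ::ₘ c ::ₘ W)
    (hW : 2 ≤ W.card) (hab : sympForm (deg a) (deg b) ≠ 0) (hac : sympForm (deg a) (deg c) ≠ 0)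
    (hφ : ∃ x ∈ W, sympForm (S.map deg).sum (deg x) ≠ 0)
    (habc : sympForm (deg a) (deg c) + sympForm (deg b) (deg c) = 0) :
    mergeResults deg ((a * b) ::ₘ c ::ₘ W) = mergeResults deg ((a * c) ::ₘ b ::ₘ W) := by
  obtain ⟨d, hdW, hφd⟩ := hφ
  by_cases hedge : ∃ x y W', W = x ::ₘ y ::ₘ W' ∧ sympForm (deg x) (deg y) ≠ 0
  · obtain ⟨x, y, W', rfl, hxy⟩ := hedge
    have hφab : sympForm (S.map deg).sum (deg a) ≠ 0 ∨ sympForm (S.map deg).sum (deg b) ≠ 0 := by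
      by_contra! h
      refine hab (sympForm_eq_zero_trans (ne_zero_left hφd) ?_ h.2)
      rw [sympForm_swap, h.1, neg_zero]
    have hv : ∃ x ∈ a ::ₘ b ::ₘ c ::ₘ W', sympForm (S.map deg).sum (deg x) ≠ 0 := by
      rcases hφab with h | h
      · exact ⟨a, by simp, h⟩
      · exact ⟨b, by simp, h⟩
    rw [hU.all_disjoint hd h0 (a := a) (b := b) (c := x) (d := y) (W := c ::ₘ W')
      (T' := a ::ₘ b ::ₘ c ::ₘ W')
      (by rw [hS]; simp only [← Multiset.singleton_add]; abel)
      (by simp only [← Multiset.singleton_add]; abel) rfl hab hxy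
      ⟨d, by simp only [Multiset.mem_cons] at hdW ⊢; tauto, hφd⟩ hv]
    exact hU.all_disjoint hd h0 (a := x) (b := y) (c := a) (d := c) (W := b ::ₘ W')
      (by rw [hS]; simp only [← Multiset.singleton_add]; abel)
      (by simp only [← Multiset.singleton_add]; abel)
      (by simp only [← Multiset.singleton_add]; abel) hxy hac hv
      ⟨d, by simp only [Multiset.mem_cons] at hdW ⊢; tauto, hφd⟩
  push Not at hedge
  obtain ⟨W₁, rfl⟩ := Multiset.exists_cons_of_mem hdW
  have hline : ∀ x ∈ W₁, sympForm (deg d) (deg x) = 0 := by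
    intro x hx
    obtain ⟨W₂, rfl⟩ := Multiset.exists_cons_of_mem hx
    exact hedge d x W₂ rfl
  have hds : sympForm (deg d) (S.map deg).sum = sympForm (deg d) (deg a) +
      sympForm (deg d) (deg b) + sympForm (deg d) (deg c) := by
    rw [hS]
    simp only [Multiset.map_cons, Multiset.sum_cons, sympForm_add_right, sympForm_self]
    rw [sympForm_sum_right, Multiset.sum_eq_zero]
    · ring
    · intro x hx
      obtain ⟨y, hy, rfl⟩ := Multiset.mem_map.mp hx
      exact hline y hy
  have hds0 := sympForm_ne_swap hφd
  rw [hds] at hds0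
  obtain ⟨e, he⟩ : ∃ e, e ∈ W₁ := by
    apply Multiset.card_pos_iff_exists_mem.mp
    simp only [Multiset.card_cons] at hW
    omega
  obtain ⟨W₂, rfl⟩ := Multiset.exists_cons_of_mem he
  have hde := hline e (by simp)
  have hd0 : deg d ≠ 0 := ne_zero_right hφd
  have he0 : deg e ≠ 0 := h0 e (by rw [hS]; simp)
  have hb0 : deg b ≠ 0 := ne_zero_right hab
  have hc0 : deg c ≠ 0 := ne_zero_right hac
  have hφe : sympForm (S.map deg).sum (deg e) ≠ 0 := by
    intro h
    apply hφd
    apply sympForm_eq_zero_trans he0 h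
    rw [sympForm_swap, hde, neg_zero]
  have hdc : sympForm (deg d) (deg c) ≠ 0 := by
    intro h
    apply hds0
    have h1 : sympForm (deg a + deg b) (deg c) = 0 := by rwa [sympForm_add_left]
    have h2 := sympForm_eq_zero_trans hc0 h1 (by rw [sympForm_swap, h, neg_zero])
    rw [h, add_zero, ← sympForm_add_right, sympForm_swap, h2, neg_zero]
  have hec : sympForm (deg e) (deg c) ≠ 0 := fun h => hdc (sympForm_eq_zero_trans he0 hde h)
  -- If `b` is parallel to `d`, the path is `ac → cb → ad → ce → ab`, starting with a triple
  -- exchange at `c`. Otherwise it is `ab → cd → be → ac`.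
  by_cases hdb : sympForm (deg d) (deg b) = 0
  · have hacb : sympForm (deg a) (deg b) + sympForm (deg c) (deg b) ≠ 0 := by
      intro h
      apply hds0
      have h1 : sympForm (deg a + deg c) (deg b) = 0 := by rwa [sympForm_add_left]
      have h2 := sympForm_eq_zero_trans hb0 h1 (by rw [sympForm_swap, hdb, neg_zero])
      rw [hdb, add_zero, ← sympForm_add_right, sympForm_swap, h2, neg_zero]
    have had : sympForm (deg a) (deg d) ≠ 0 := fun h => hab (sympForm_eq_zero_trans hd0 h hdb)
    have hba := sympForm_swap (deg a) (deg b)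
    have hca := sympForm_swap (deg a) (deg c)
    have hcb := sympForm_swap (deg b) (deg c)
    have t1 : mergeResults deg ((c * a) ::ₘ b ::ₘ d ::ₘ e ::ₘ W₂) =
        mergeResults deg ((c * b) ::ₘ a ::ₘ d ::ₘ e ::ₘ W₂) :=
      hU.triple hd h0 (by rw [hS]; simp only [← Multiset.singleton_add]; abel) rfl rfl
        (sympForm_ne_swap hac) (by grind) (by grind) (by grind) (Or.inr ⟨d, by simp, hφd⟩)
    have t2 : mergeResults deg ((c * b) ::ₘ a ::ₘ d ::ₘ e ::ₘ W₂) =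
        mergeResults deg ((a * d) ::ₘ c ::ₘ b ::ₘ e ::ₘ W₂) :=
      hU.all_disjoint hd h0 (by rw [hS]; simp only [← Multiset.singleton_add]; abel) rfl rfl
        (by grind) had ⟨d, by simp, hφd⟩ ⟨e, by simp, hφe⟩
    have t3 : mergeResults deg ((a * d) ::ₘ c ::ₘ b ::ₘ e ::ₘ W₂) =
        mergeResults deg ((c * e) ::ₘ a ::ₘ b ::ₘ d ::ₘ W₂) :=
      hU.all_disjoint hd h0 (W := b ::ₘ W₂)
        (by rw [hS]; simp only [← Multiset.singleton_add]; abel)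
        (by simp only [← Multiset.singleton_add]; abel)
        (by simp only [← Multiset.singleton_add]; abel)
        had (sympForm_ne_swap hec) ⟨e, by simp, hφe⟩ ⟨d, by simp, hφd⟩
    have t4 : mergeResults deg ((c * e) ::ₘ a ::ₘ b ::ₘ d ::ₘ W₂) =
        mergeResults deg ((a * b) ::ₘ c ::ₘ d ::ₘ e ::ₘ W₂) :=
      hU.all_disjoint hd h0 (W := d ::ₘ W₂)
        (by rw [hS]; simp only [← Multiset.singleton_add]; abel) rfl
        (by simp only [← Multiset.singleton_add]; abel)
        (sympForm_ne_swap hec) hab ⟨d, by simp, hφd⟩ ⟨d, by simp, hφd⟩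
    rw [hd.comm a c, t1, t2, t3, t4]
  · have heb : sympForm (deg e) (deg b) ≠ 0 := fun h => hdb (sympForm_eq_zero_trans he0 hde h)
    have t1 : mergeResults deg ((a * b) ::ₘ c ::ₘ d ::ₘ e ::ₘ W₂) =
        mergeResults deg ((c * d) ::ₘ a ::ₘ b ::ₘ e ::ₘ W₂) :=
      hU.all_disjoint hd h0 hS rfl rfl hab (sympForm_ne_swap hdc) ⟨d, by simp, hφd⟩
        ⟨e, by simp, hφe⟩
    have t2 : mergeResults deg ((c * d) ::ₘ a ::ₘ b ::ₘ e ::ₘ W₂) =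
        mergeResults deg ((b * e) ::ₘ a ::ₘ c ::ₘ d ::ₘ W₂) :=
      hU.all_disjoint hd h0 (W := a ::ₘ W₂)
        (by rw [hS]; simp only [← Multiset.singleton_add]; abel)
        (by simp only [← Multiset.singleton_add]; abel)
        (by simp only [← Multiset.singleton_add]; abel)
        (sympForm_ne_swap hdc) (sympForm_ne_swap heb) ⟨e, by simp, hφe⟩ ⟨d, by simp, hφd⟩
    have t3 : mergeResults deg ((b * e) ::ₘ a ::ₘ c ::ₘ d ::ₘ W₂) =
        mergeResults deg ((a * c) ::ₘ b ::ₘ d ::ₘ e ::ₘ W₂) :=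
      hU.all_disjoint hd h0 (W := d ::ₘ W₂)
        (by rw [hS]; simp only [← Multiset.singleton_add]; abel) rfl
        (by simp only [← Multiset.singleton_add]; abel)
        (sympForm_ne_swap heb) hac ⟨d, by simp, hφd⟩ ⟨d, by simp, hφd⟩
    rw [t1, t2, t3]

theorem UniqueBelow.share (hd : IsSympMagma deg) {S W : Multiset H} {a b c : H}
    (hU : UniqueBelow deg S) (h0 : ∀ x ∈ S, deg x ≠ 0) (hS : S = a ::ₘ b ::ₘ c ::ₘ W)
    (hab : sympForm (deg a) (deg b) ≠ 0) (hac : sympForm (deg a) (deg c) ≠ 0)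
    (hv₁ : ∃ x ∈ c ::ₘ W, sympForm (S.map deg).sum (deg x) ≠ 0)
    (hv₂ : ∃ x ∈ b ::ₘ W, sympForm (S.map deg).sum (deg x) ≠ 0) :
    mergeResults deg ((a * b) ::ₘ c ::ₘ W) = mergeResults deg ((a * c) ::ₘ b ::ₘ W) := by
  obtain h | h | h : W.card = 0 ∨ W.card = 1 ∨ 2 ≤ W.card := by omega
  · obtain rfl := Multiset.card_eq_zero.mp h
    have hs : (S.map deg).sum = deg a + (deg b + deg c) := by rw [hS]; simp
    simp only [hs, Multiset.mem_cons, Multiset.notMem_zero, or_false,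
      exists_eq_left, sympForm_add_left, sympForm_self, add_zero, zero_add] at hv₁ hv₂
    exact hU.triple hd h0 hS rfl rfl hab hac hv₁ hv₂ (Or.inl rfl)
  · obtain ⟨d, rfl⟩ := Multiset.card_eq_one.mp h
    have h4 := hU.fourExchange hd (by rw [hS]; simp)
    have hs : (S.map deg).sum = deg a + (deg b + (deg c + deg d)) := by rw [hS]; simp
    apply h4.share hab hac
    · simp only [hs, Multiset.mem_cons, Multiset.mem_singleton, exists_eq_or_imp,
        exists_eq_left, sympForm_add_left, sympForm_self] at hv₁
      simpa [add_assoc] using hv₁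
    · simp only [hs, Multiset.mem_cons, Multiset.mem_singleton, exists_eq_or_imp,
        exists_eq_left, sympForm_add_left, sympForm_self] at hv₂
      simpa [add_assoc] using hv₂
    · by_contra! h
      refine hab (sympForm_eq_zero_trans (h0 d (by rw [hS]; simp)) h.1 ?_)
      rw [sympForm_swap, h.2, neg_zero]
  by_cases hφ : ∃ x ∈ W, sympForm (S.map deg).sum (deg x) ≠ 0
  · by_cases habc : sympForm (deg a) (deg c) + sympForm (deg b) (deg c) = 0
    · exact hU.share_of_eq_zero hd h0 hS h hab hac hφ habc
    · by_cases hacb : sympForm (deg a) (deg b) + sympForm (deg c) (deg b) = 0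
      · exact (hU.share_of_eq_zero hd h0 (by rw [hS, Multiset.cons_swap b c]) h hac hab hφ
          hacb).symm
      · exact hU.triple hd h0 hS rfl rfl hab hac habc hacb (Or.inr hφ)
  -- All of `W` lies on the line of `s` while `b` and `c` do not, so two elements `d, e` of `W` give
  -- `ab → cd → be → ac`.
  · push Not at hφ
    have hφc : sympForm (S.map deg).sum (deg c) ≠ 0 := by
      obtain ⟨x, hx, hx'⟩ := hv₁
      rcases Multiset.mem_cons.mp hx with rfl | hx
      · exact hx'
      · exact absurd (hφ x hx) hx'
    have hφb : sympForm (S.map deg).sum (deg b) ≠ 0 := by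
      obtain ⟨x, hx, hx'⟩ := hv₂
      rcases Multiset.mem_cons.mp hx with rfl | hx
      · exact hx'
      · exact absurd (hφ x hx) hx'
    obtain ⟨d, hdW⟩ := Multiset.card_pos_iff_exists_mem.mp (by omega : 0 < W.card)
    obtain ⟨W, rfl⟩ := Multiset.exists_cons_of_mem hdW
    simp only [Multiset.card_cons] at h
    obtain ⟨e, heW⟩ := Multiset.card_pos_iff_exists_mem.mp (by omega : 0 < W.card)
    obtain ⟨W, rfl⟩ := Multiset.exists_cons_of_mem heW
    have hd0 : deg d ≠ 0 := h0 d (by rw [hS]; simp)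
    have he0 : deg e ≠ 0 := h0 e (by rw [hS]; simp)
    have hcd := sympForm_ne_of_mem_line hd0 (hφ d (by simp)) hφc
    have hbe := sympForm_ne_of_mem_line he0 (hφ e (by simp)) hφb
    have t1 : mergeResults deg ((a * b) ::ₘ c ::ₘ d ::ₘ e ::ₘ W) =
        mergeResults deg ((c * d) ::ₘ a ::ₘ b ::ₘ e ::ₘ W) :=
      hU.all_disjoint hd h0 hS rfl rfl hab hcd ⟨c, by simp, hφc⟩ ⟨b, by simp, hφb⟩
    have t2 : mergeResults deg ((c * d) ::ₘ a ::ₘ b ::ₘ e ::ₘ W) =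
        mergeResults deg ((b * e) ::ₘ a ::ₘ c ::ₘ d ::ₘ W) :=
      hU.all_disjoint hd h0 (W := a ::ₘ W)
        (by rw [hS]; simp only [← Multiset.singleton_add]; abel)
        (by simp only [← Multiset.singleton_add]; abel)
        (by simp only [← Multiset.singleton_add]; abel)
        hcd hbe ⟨b, by simp, hφb⟩ ⟨c, by simp, hφc⟩
    have t3 : mergeResults deg ((b * e) ::ₘ a ::ₘ c ::ₘ d ::ₘ W) =
        mergeResults deg ((a * c) ::ₘ b ::ₘ d ::ₘ e ::ₘ W) :=
      hU.all_disjoint hd h0 (W := d ::ₘ W)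
        (by rw [hS]; simp only [← Multiset.singleton_add]; abel) rfl
        (by simp only [← Multiset.singleton_add]; abel)
        hbe hac ⟨c, by simp, hφc⟩ ⟨b, by simp, hφb⟩
    rw [t1, t2, t3]

/-- The two pairs coincide, share one element or are disjoint. Commutativity reduces the overlapping
cases to a shared first factor. -/
theorem UniqueBelow.all_pairs (hd : IsSympMagma deg) {S R R' : Multiset H} {a b c d : H}
    (hU : UniqueBelow deg S) (hS : S = a ::ₘ b ::ₘ R) (hS' : S = c ::ₘ d ::ₘ R')
    (hab : sympForm (deg a) (deg b) ≠ 0) (hcd : sympForm (deg c) (deg d) ≠ 0)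
    (hne : (mergeResults deg ((a * b) ::ₘ R)).Nonempty)
    (hne' : (mergeResults deg ((c * d) ::ₘ R')).Nonempty) :
    mergeResults deg ((a * b) ::ₘ R) = mergeResults deg ((c * d) ::ₘ R') := by
  have h0 : ∀ x ∈ S, deg x ≠ 0 := by
    obtain ⟨v, hv⟩ := hne
    have := MergesTo.merge a b R v hab hv
    rw [← hS] at this
    exact (this.mergeable hd (by rw [hS]; simp)).1
  have share : ∀ {x y z W}, S = x ::ₘ y ::ₘ z ::ₘ W → sympForm (deg x) (deg y) ≠ 0 →
      sympForm (deg x) (deg z) ≠ 0 → (mergeResults deg ((x * y) ::ₘ z ::ₘ W)).Nonempty →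
      (mergeResults deg ((x * z) ::ₘ y ::ₘ W)).Nonempty →
      mergeResults deg ((x * y) ::ₘ z ::ₘ W) = mergeResults deg ((x * z) ::ₘ y ::ₘ W) := by
    intro x y z W hSx hxy hxz h1 h2
    exact hU.share hd h0 hSx hxy hxz (exists_of_mergeResults hd hSx (by simp) h1)
      (exists_of_mergeResults hd (a := x) (b := z) (by rw [hSx, Multiset.cons_swap y z])
        (by simp) h2)
  have h := hS.symm.trans hS'
  rcases Multiset.cons_eq_cons.mp h with ⟨rfl, h'⟩ | ⟨-, U, h1, h2⟩
  · rcases Multiset.cons_eq_cons.mp h' with ⟨rfl, rfl⟩ | ⟨-, W, rfl, rfl⟩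
    · rfl
    · exact share hS hab hcd hne hne'
  · rcases Multiset.cons_eq_cons.mp h1 with ⟨rfl, rfl⟩ | ⟨-, V, rfl, rfl⟩
    · rcases Multiset.cons_eq_cons.mp h2 with ⟨rfl, rfl⟩ | ⟨-, W, rfl, rfl⟩
      · rw [hd.comm]
      · rw [hd.comm a b] at hne ⊢
        exact share (by rw [hS, Multiset.cons_swap]) (sympForm_ne_swap hab) hcd hne hne'
    · rcases Multiset.cons_eq_cons.mp h2 with ⟨rfl, rfl⟩ | ⟨-, W, rfl, h3⟩
      · rw [hd.comm c d] at hne' ⊢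
        exact share hS hab (sympForm_ne_swap hcd) hne hne'
      · rcases Multiset.cons_eq_cons.mp h3 with ⟨rfl, rfl⟩ | ⟨-, Y, rfl, rfl⟩
        · rw [hd.comm a b] at hne ⊢
          rw [hd.comm c b] at hne' ⊢
          exact share (by rw [hS, Multiset.cons_swap]) (sympForm_ne_swap hab)
            (sympForm_ne_swap hcd) hne hne'
        · exact hU.all_disjoint hd h0 hS rfl rfl hab hcd
            (exists_of_mergeResults hd hS (by simp) hne)
            (exists_of_mergeResults hd hS' (by simp) hne')

/-- The result of merging a multiset does not depend on the choices made. -/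
theorem mergeResults_subsingleton (hd : IsSympMagma deg) (S : Multiset H) :
    (mergeResults deg S).Subsingleton := by
  induction hn : S.card using Nat.strong_induction_on generalizing S with
  | _ n ih =>
    have hU : UniqueBelow deg S := fun T hT => ih T.card (hn ▸ hT) T rfl
    have cases' : ∀ {v}, MergesTo deg S v → S = {v} ∨ ∃ a b R, S = a ::ₘ b ::ₘ R ∧
        sympForm (deg a) (deg b) ≠ 0 ∧ v ∈ mergeResults deg ((a * b) ::ₘ R) := by
      intro v hv
      cases hv with
      | single a => exact Or.inl rfl
      | merge a b R v hab h => exact Or.inr ⟨a, b, R, rfl, hab, h⟩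
    intro v hv w hw
    rcases cases' hv with h | ⟨a, b, R, hS, hab, h⟩ <;>
      rcases cases' hw with h' | ⟨c, d, R', hS', hcd, h'⟩
    · exact Multiset.singleton_inj.mp (h.symm.trans h')
    · have := congrArg Multiset.card (h.symm.trans hS')
      simp at this
    · have := congrArg Multiset.card (h'.symm.trans hS)
      simp at this
    · have heq := hU.all_pairs hd hS hS' hab hcd ⟨v, h⟩ ⟨w, h'⟩
      rw [heq] at h
      exact hU ((c * d) ::ₘ R') (by rw [hS']; simp) h h'

end MergeUnique

/-! ### Graded substitutions in the free Lie algebra. -/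

section Substitution

variable {K : Type*} [Field K] {G : Type*} {g₁ g₂ g₃ g₄ : G} {x₁ x₂ x₃ x₄ : FreeGradedLie K G}

open Classical in
/-- The substitution of given elements for `x_1, …, x_4`. -/
noncomputable def substFour (g₁ g₂ g₃ g₄ : G) (x₁ x₂ x₃ x₄ : FreeGradedLie K G) : G × ℕ → FreeGradedLie K G :=
  fun p => if p = (g₁, 1) then x₁ else if p = (g₂, 2) then x₂ else if p = (g₃, 3) then x₃
    else if p = (g₄, 4) then x₄ else gvar K p.2 p.1

theorem lift_substFour_one :
    FreeLieAlgebra.lift K (substFour g₁ g₂ g₃ g₄ x₁ x₂ x₃ x₄) (gvar K 1 g₁) = x₁ := by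
  simp [gvar, FreeLieAlgebra.lift_of_apply, substFour]

theorem lift_substFour_two :
    FreeLieAlgebra.lift K (substFour g₁ g₂ g₃ g₄ x₁ x₂ x₃ x₄) (gvar K 2 g₂) = x₂ := by
  simp [gvar, FreeLieAlgebra.lift_of_apply, substFour]

theorem lift_substFour_three :
    FreeLieAlgebra.lift K (substFour g₁ g₂ g₃ g₄ x₁ x₂ x₃ x₄) (gvar K 3 g₃) = x₃ := by
  simp [gvar, FreeLieAlgebra.lift_of_apply, substFour]

theorem lift_substFour_four :
    FreeLieAlgebra.lift K (substFour g₁ g₂ g₃ g₄ x₁ x₂ x₃ x₄) (gvar K 4 g₄) = x₄ := by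
  simp [gvar, FreeLieAlgebra.lift_of_apply, substFour]

end Substitution

section GradedSubstitution

variable {K : Type*} [Field K] {G : Type*} [AddCommGroup G]

theorem lie_mem_freeComponent {g h : G} {x y : FreeGradedLie K G} (hx : x ∈ freeComponent K g)
    (hy : y ∈ freeComponent K h) : ⁅x, y⁆ ∈ freeComponent K (g + h) := by
  induction hx using Submodule.span_induction with
  | mem x hx =>
    induction hy using Submodule.span_induction with
    | mem y hy => exact Submodule.subset_span (.bracket hx hy)
    | zero => simp
    | add y z _ _ hy hz => rw [lie_add]; exact add_mem hy hz
    | smul r y _ hy => rw [lie_smul]; exact Submodule.smul_mem _ _ hy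
  | zero => simp
  | add y z _ _ hy hz => rw [add_lie]; exact add_mem hy hz
  | smul r y _ hy => rw [smul_lie]; exact Submodule.smul_mem _ _ hy

theorem gvar_mem_freeComponent (i : ℕ) (g : G) : gvar K i g ∈ freeComponent K g :=
  Submodule.subset_span (.var i g)

theorem lift_mem_of_mem_freeComponent {L : Type*} [LieRing L] [LieAlgebra K L]
    (D : G → Submodule K L) (hD : ∀ g h, ∀ x ∈ D g, ∀ y ∈ D h, ⁅x, y⁆ ∈ D (g + h))
    {ψ : G × ℕ → L} (hψ : ∀ x, ψ x ∈ D x.1) {g : G} {f : FreeGradedLie K G}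
    (hf : f ∈ freeComponent K g) : FreeLieAlgebra.lift K ψ f ∈ D g := by
  induction hf using Submodule.span_induction with
  | mem f hf =>
    induction hf with
    | var i g => rw [gvar, FreeLieAlgebra.lift_of_apply]; exact hψ (g, i)
    | bracket _ _ ha hb => rw [LieHom.map_lie]; exact hD _ _ _ ha _ hb
  | zero => simp
  | add y z _ _ hy hz => rw [map_add]; exact add_mem hy hz
  | smul r y _ hy => rw [map_smul]; exact Submodule.smul_mem _ _ hy

theorem isGradedEnd_lift {ψ : G × ℕ → FreeGradedLie K G} (hψ : ∀ x, ψ x ∈ freeComponent K x.1) :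
    IsGradedEnd (FreeLieAlgebra.lift K ψ) := fun _ _ hf =>
  lift_mem_of_mem_freeComponent (freeComponent K)
    (fun _ _ _ hx _ hy => lie_mem_freeComponent hx hy) hψ hf

/-- The monomials span the free graded Lie algebra. -/
theorem span_isGradedMonomial :
    Submodule.span K {f : FreeGradedLie K G | ∃ g, IsGradedMonomial f g} = ⊤ := by
  set P := Submodule.span K {f : FreeGradedLie K G | ∃ g, IsGradedMonomial f g}
  have hlie : ∀ {x y}, x ∈ P → y ∈ P → ⁅x, y⁆ ∈ P := by
    intro x y hx hy
    induction hx using Submodule.span_induction with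
    | mem x hx =>
      induction hy using Submodule.span_induction with
      | mem y hy =>
        obtain ⟨g, hg⟩ := hx
        obtain ⟨h, hh⟩ := hy
        exact Submodule.subset_span ⟨_, .bracket hg hh⟩
      | zero => simp
      | add y z _ _ hy hz => rw [lie_add]; exact add_mem hy hz
      | smul r y _ hy => rw [lie_smul]; exact Submodule.smul_mem _ _ hy
    | zero => simp
    | add y z _ _ hy hz => rw [add_lie]; exact add_mem hy hz
    | smul r y _ hy => rw [smul_lie]; exact Submodule.smul_mem _ _ hy
  -- The universal property gives a map into this subalgebra; followed by the inclusion it fixes the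
  -- variables, so it is the identity.
  let S : LieSubalgebra K (FreeGradedLie K G) := { P with lie_mem' := hlie }
  let φ : FreeGradedLie K G →ₗ⁅K⁆ S := FreeLieAlgebra.lift K
    fun x => ⟨FreeLieAlgebra.of K x, Submodule.subset_span ⟨x.1, .var x.2 x.1⟩⟩
  have hφ : S.incl.comp φ = LieHom.id := by
    apply FreeLieAlgebra.hom_ext
    intro x
    simp [φ]
  rw [eq_top_iff]
  intro f _
  have h : (φ f : FreeGradedLie K G) = f := congrArg (fun e => e f) hφ
  rw [← h]
  exact (φ f).2

variable {L : Type*} [LieRing L] [LieAlgebra K L] {Γ : G → Submodule K L}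

/-- The graded identities of a graded Lie algebra form an ideal. -/
def gradedIdentityIdeal (Γ : G → Submodule K L) : LieIdeal K (FreeGradedLie K G) where
  carrier := gradedIdentities Γ
  zero_mem' := fun _ _ => by simp
  add_mem' := fun hf hg a ha => by rw [map_add, hf a ha, hg a ha, add_zero]
  smul_mem' := fun r f hf a ha => by rw [map_smul, hf a ha, smul_zero]
  lie_mem := fun {x f} hf a ha => by
    have := hf a ha
    rw [LieHom.map_lie, this, lie_zero]

/-- A graded endomorphism followed by an admissible evaluation is again an admissible evaluation. -/
theorem isTIdeal_gradedIdentityIdeal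
    (hΓ : ∀ g h, ∀ x ∈ Γ g, ∀ y ∈ Γ h, ⁅x, y⁆ ∈ Γ (g + h)) : IsTIdeal (gradedIdentityIdeal Γ) := by
  intro φ hφ f hf a ha
  have hcomp : (FreeLieAlgebra.lift K a).comp φ =
      FreeLieAlgebra.lift K fun x => FreeLieAlgebra.lift K a (φ (FreeLieAlgebra.of K x)) := by
    apply FreeLieAlgebra.hom_ext
    intro x
    rw [FreeLieAlgebra.lift_of_apply, LieHom.comp_apply]
  rw [← LieHom.comp_apply, hcomp]
  apply hf
  intro g i
  exact lift_mem_of_mem_freeComponent Γ hΓ (fun x => ha x.1 x.2)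
    (hφ g _ (gvar_mem_freeComponent i g))

theorem tIdealSpan_le {S : Set (FreeGradedLie K G)} {I : LieIdeal K (FreeGradedLie K G)}
    (hI : IsTIdeal I) (hS : S ⊆ (I : Set (FreeGradedLie K G))) : tIdealSpan S ≤ I :=
  sInf_le ⟨hI, hS⟩

variable {I : LieIdeal K (FreeGradedLie K G)} {g₁ g₂ g₃ g₄ : G} {x₁ x₂ x₃ x₄ : FreeGradedLie K G}

theorem substFour_mem (h₁ : x₁ ∈ freeComponent K g₁) (h₂ : x₂ ∈ freeComponent K g₂)
    (h₃ : x₃ ∈ freeComponent K g₃) (h₄ : x₄ ∈ freeComponent K g₄) (p : G × ℕ) :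
    substFour g₁ g₂ g₃ g₄ x₁ x₂ x₃ x₄ p ∈ freeComponent K p.1 := by
  unfold substFour
  split_ifs with h h h h
  · rwa [h]
  · rwa [h]
  · rwa [h]
  · rwa [h]
  · exact gvar_mem_freeComponent _ _

theorem IsTIdeal.lift_substFour_mem (hI : IsTIdeal I) (h₁ : x₁ ∈ freeComponent K g₁)
    (h₂ : x₂ ∈ freeComponent K g₂) (h₃ : x₃ ∈ freeComponent K g₃) (h₄ : x₄ ∈ freeComponent K g₄)
    {f : FreeGradedLie K G} (hf : f ∈ I) :
    FreeLieAlgebra.lift K (substFour g₁ g₂ g₃ g₄ x₁ x₂ x₃ x₄) f ∈ I :=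
  hI _ (isGradedEnd_lift (substFour_mem h₁ h₂ h₃ h₄)) f hf

theorem IsTIdeal.cubic_mem (hI : IsTIdeal I) (h₁ : x₁ ∈ freeComponent K g₁)
    (h₂ : x₂ ∈ freeComponent K g₂) (h₃ : x₃ ∈ freeComponent K g₃) {c : K}
    (hf : cubicPoly c g₁ g₂ g₃ ∈ I) : ⁅⁅x₁, x₃⁆, x₂⁆ - c • ⁅⁅x₁, x₂⁆, x₃⁆ ∈ I := by
  -- The fourth variable does not occur, so its slot is filled with zero.
  have := hI.lift_substFour_mem h₁ h₂ h₃ (zero_mem (freeComponent K (0 : G))) hf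
  simpa only [cubicPoly, comm3, map_sub, map_smul, LieHom.map_lie, lift_substFour_one,
    lift_substFour_two, lift_substFour_three] using this

theorem IsTIdeal.quartic_mem (hI : IsTIdeal I) (h₁ : x₁ ∈ freeComponent K g₁)
    (h₂ : x₂ ∈ freeComponent K g₂) (h₃ : x₃ ∈ freeComponent K g₃) (h₄ : x₄ ∈ freeComponent K g₄)
    {c : K} (hf : quarticPoly c g₁ g₂ g₃ g₄ ∈ I) :
    ⁅⁅⁅x₄, x₁⁆, x₂⁆, x₃⁆ - c • ⁅⁅⁅x₄, x₃⁆, x₂⁆, x₁⁆ ∈ I := by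
  have := hI.lift_substFour_mem h₁ h₂ h₃ h₄ hf
  simpa only [quarticPoly, comm4, map_sub, map_smul, LieHom.map_lie, lift_substFour_one,
    lift_substFour_two, lift_substFour_three, lift_substFour_four] using this

theorem IsTIdeal.lie_mem_of_gvar (hI : IsTIdeal I) (h₁ : x₁ ∈ freeComponent K g₁)
    (h₂ : x₂ ∈ freeComponent K g₂) (hf : ⁅gvar K 1 g₁, gvar K 2 g₂⁆ ∈ I) : ⁅x₁, x₂⁆ ∈ I := by
  have := hI.lift_substFour_mem h₁ h₂ (zero_mem (freeComponent K (0 : G)))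
    (zero_mem (freeComponent K (0 : G))) hf
  simpa only [LieHom.map_lie, lift_substFour_one, lift_substFour_two] using this

theorem IsTIdeal.mem_of_gvar (hI : IsTIdeal I) (h₁ : x₁ ∈ freeComponent K g₁)
    (hf : gvar K 1 g₁ ∈ I) : x₁ ∈ I := by
  have := hI.lift_substFour_mem h₁ (zero_mem (freeComponent K (0 : G)))
    (zero_mem (freeComponent K (0 : G))) (zero_mem (freeComponent K (0 : G))) hf
  simpa only [lift_substFour_one] using this

end GradedSubstitution

/-! ### Gradings with one-dimensional components: the scalars and the normalized quotient. -/

section PauliBasis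

variable {K : Type*} [Field K] {k : Type*} [Field k] {L : Type*} [LieRing L] [LieAlgebra K L]

/-- The grading `Γ` of `L` by the plane `k × k` has one-dimensional components `Γ g = K u_g` for
`g ≠ 0` and `Γ 0 = 0`, with `[u_g, u_h] = c(g, h) u_{g + h}`, where `c(g, h)` vanishes exactly
when `g` and `h` are linearly dependent. -/
structure IsPauliBasis (Γ : k × k → Submodule K L) (u : k × k → L) (c : k × k → k × k → K) :
    Prop where
  span : ∀ g, Γ g = Submodule.span K {u g}
  zero : u 0 = 0
  lie : ∀ g h, ⁅u g, u h⁆ = c g h • u (g + h)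
  swap : ∀ g h, c h g = -c g h
  coeff_eq_zero : ∀ g h, c g h = 0 ↔ sympForm g h = 0
  exists_dual : ∀ g, g ≠ 0 → ∃ τ : L →ₗ[K] K, τ (u g) ≠ 0 ∧ ∀ h, h ≠ g → τ (u h) = 0

/-- The scalar `λ_{g,h,k}` for structure constants `c`. -/
def cubicScalar (c : k × k → k × k → K) (g h l : k × k) : K :=
  c g l * c (g + l) h / (c g h * c (g + h) l)

/-- The scalar `λ_{(g₁,g₂,g₃,g₄)}` for structure constants `c`. -/
def quarticScalar (c : k × k → k × k → K) (g₁ g₂ g₃ g₄ : k × k) : K :=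
  c g₄ g₁ * c (g₄ + g₁) g₂ * c (g₄ + g₁ + g₂) g₃ /
    (c g₄ g₃ * c (g₄ + g₃) g₂ * c (g₄ + g₃ + g₂) g₁)

/-- The evaluation at `x_i^g ↦ t_{g,i} u_g`. -/
noncomputable def scaledEval (u : k × k → L) (t : (k × k) × ℕ → K) :
    FreeGradedLie K (k × k) →ₗ⁅K⁆ L :=
  FreeLieAlgebra.lift K fun x => t x • u x.1

namespace IsPauliBasis

variable {Γ : k × k → Submodule K L} {u : k × k → L} {c : k × k → k × k → K}

theorem ne_zero (hu : IsPauliBasis Γ u c) {g : k × k} (hg : g ≠ 0) : u g ≠ 0 := by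
  obtain ⟨τ, hτ, -⟩ := hu.exists_dual g hg
  intro h
  rw [h, map_zero] at hτ
  exact hτ rfl

theorem mem_gradedIdentities (hu : IsPauliBasis Γ u c) {f : FreeGradedLie K (k × k)} :
    f ∈ gradedIdentities Γ ↔ ∀ t, scaledEval u t f = 0 := by
  constructor
  · intro hf t
    apply hf
    intro g i
    rw [hu.span]
    exact Submodule.smul_mem _ _ (Submodule.mem_span_singleton_self _)
  · intro h a ha
    have : ∀ x : (k × k) × ℕ, ∃ r : K, r • u x.1 = a x := by
      intro x
      have hx := ha x.1 x.2
      rw [hu.span] at hx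
      exact Submodule.mem_span_singleton.mp hx
    choose t ht using this
    rw [← funext ht]
    exact h t

theorem lie_mem (hu : IsPauliBasis Γ u c) (g h : k × k) (x : L) (hx : x ∈ Γ g) (y : L)
    (hy : y ∈ Γ h) : ⁅x, y⁆ ∈ Γ (g + h) := by
  rw [hu.span] at hx hy ⊢
  obtain ⟨r, rfl⟩ := Submodule.mem_span_singleton.mp hx
  obtain ⟨s, rfl⟩ := Submodule.mem_span_singleton.mp hy
  rw [smul_lie, lie_smul, hu.lie]
  exact Submodule.smul_mem _ _ (Submodule.smul_mem _ _ (Submodule.smul_mem _ _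
    (Submodule.mem_span_singleton_self _)))

theorem coeff_ne_zero (hu : IsPauliBasis Γ u c) {g h : k × k} :
    c g h ≠ 0 ↔ sympForm g h ≠ 0 := (hu.coeff_eq_zero g h).not

theorem mem_gradingSupport (hu : IsPauliBasis Γ u c) {g : k × k} :
    g ∈ gradingSupport Γ ↔ g ≠ 0 := by
  rw [gradingSupport, Set.mem_ofPred_eq, hu.span, Ne, Submodule.span_singleton_eq_bot]
  constructor
  · rintro h rfl
    exact h hu.zero
  · exact hu.ne_zero

theorem mem_gradingCentralizer (hu : IsPauliBasis Γ u c) {g h : k × k} (hgh : c g h = 0) :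
    h ∈ gradingCentralizer Γ g := by
  intro x hx y hy
  rw [hu.span] at hx hy
  obtain ⟨r, rfl⟩ := Submodule.mem_span_singleton.mp hx
  obtain ⟨s, rfl⟩ := Submodule.mem_span_singleton.mp hy
  rw [smul_lie, lie_smul, hu.lie, hgh, zero_smul, smul_zero, smul_zero]

theorem scaledEval_gvar {k : Type*} {u : k × k → L} (t : (k × k) × ℕ → K) (i : ℕ) (g : k × k) :
    scaledEval u t (gvar K i g) = t (g, i) • u g := by
  rw [scaledEval, gvar, FreeLieAlgebra.lift_of_apply]

theorem lie_smul_smul (hu : IsPauliBasis Γ u c) (r s : K) (g h : k × k) :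
    ⁅r • u g, s • u h⁆ = (r * s * c g h) • u (g + h) := by
  rw [smul_lie, lie_smul, hu.lie, smul_smul, smul_smul, mul_assoc]

theorem scaledEval_comm3 (hu : IsPauliBasis Γ u c) (t : (k × k) × ℕ → K) (i : ℕ) (g : k × k)
    (j : ℕ) (h : k × k) (n : ℕ) (l : k × k) :
    scaledEval u t (comm3 K i g j h n l) =
      (t (g, i) * t (h, j) * t (l, n) * (c g h * c (g + h) l)) • u (g + h + l) := by
  rw [comm3, LieHom.map_lie, LieHom.map_lie, scaledEval_gvar, scaledEval_gvar, scaledEval_gvar,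
    hu.lie_smul_smul, hu.lie_smul_smul]
  congr 1
  ring

theorem scaledEval_comm4 (hu : IsPauliBasis Γ u c) (t : (k × k) × ℕ → K) (i : ℕ) (g : k × k)
    (j : ℕ) (h : k × k) (n : ℕ) (l : k × k) (m : ℕ) (r : k × k) :
    scaledEval u t (comm4 K i g j h n l m r) =
      (t (g, i) * t (h, j) * t (l, n) * t (r, m) * (c g h * c (g + h) l * c (g + h + l) r)) •
        u (g + h + l + r) := by
  have := hu.scaledEval_comm3 t i g j h n l
  rw [comm3] at this
  rw [comm4, LieHom.map_lie, this, scaledEval_gvar, hu.lie_smul_smul]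
  congr 1
  ring

theorem cubicAdmissible_iff (hu : IsPauliBasis Γ u c) {g h l : k × k} :
    CubicAdmissible Γ g h l ↔ c g h * c (g + h) l ≠ 0 := by
  rw [CubicAdmissible, hu.mem_gradedIdentities, not_iff_not]
  constructor
  · intro H
    by_contra hc
    -- Evaluate every `x_i^g` at `u_g` itself.
    have h1 := H 1
    rw [hu.scaledEval_comm3] at h1
    simp only [Pi.one_apply, mul_one, one_mul] at h1
    have h2 := hu.coeff_ne_zero.mp (right_ne_zero_of_mul hc)
    exact (smul_ne_zero hc (hu.ne_zero (add_ne_zero_of_sympForm h2))) h1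
  · intro hc t
    rw [hu.scaledEval_comm3, hc, mul_zero, zero_smul]

theorem comm4_notMem_iff (hu : IsPauliBasis Γ u c) {i j n m : ℕ} {g h l r : k × k} :
    comm4 K i g j h n l m r ∉ gradedIdentities Γ ↔
      c g h * c (g + h) l * c (g + h + l) r ≠ 0 := by
  rw [hu.mem_gradedIdentities, not_iff_not]
  constructor
  · intro H
    by_contra hc
    have h1 := H 1
    rw [hu.scaledEval_comm4] at h1
    simp only [Pi.one_apply, mul_one, one_mul] at h1
    have h2 := hu.coeff_ne_zero.mp (right_ne_zero_of_mul hc)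
    exact (smul_ne_zero hc (hu.ne_zero (add_ne_zero_of_sympForm h2))) h1
  · intro hc t
    rw [hu.scaledEval_comm4, hc, mul_zero, zero_smul]

theorem cubicPoly_mem_iff (hu : IsPauliBasis Γ u c) {g h l : k × k}
    (hA : CubicAdmissible Γ g h l) (r : K) :
    cubicPoly r g h l ∈ gradedIdentities Γ ↔ r = cubicScalar c g h l := by
  rw [hu.cubicAdmissible_iff] at hA
  have hne := hu.ne_zero (add_ne_zero_of_sympForm
    (hu.coeff_ne_zero.mp (right_ne_zero_of_mul hA)))
  have hev : ∀ t, scaledEval u t (cubicPoly r g h l) = (t (g, 1) * t (h, 2) * t (l, 3) *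
      (c g l * c (g + l) h - r * (c g h * c (g + h) l))) • u (g + h + l) := by
    intro t
    rw [cubicPoly, map_sub, map_smul, hu.scaledEval_comm3, hu.scaledEval_comm3,
      add_right_comm g l h, smul_smul, ← sub_smul]
    congr 1
    ring
  rw [hu.mem_gradedIdentities, cubicScalar, eq_div_iff hA]
  constructor
  · intro H
    have h1 := H 1
    rw [hev] at h1
    simp only [Pi.one_apply, mul_one, one_mul, smul_eq_zero, hne, or_false] at h1
    exact (sub_eq_zero.mp h1).symm
  · intro H t
    rw [hev, H, sub_self, mul_zero, zero_smul]

theorem quarticAdmissible_iff (hu : IsPauliBasis Γ u c) {g₁ g₂ g₃ g₄ : k × k} :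
    QuarticAdmissible Γ g₁ g₂ g₃ g₄ ↔
      c g₄ g₁ * c (g₄ + g₁) g₂ * c (g₄ + g₁ + g₂) g₃ ≠ 0 ∧
        c g₄ g₃ * c (g₄ + g₃) g₂ * c (g₄ + g₃ + g₂) g₁ ≠ 0 := by
  rw [QuarticAdmissible, hu.comm4_notMem_iff, hu.comm4_notMem_iff]

theorem quarticPoly_mem_iff (hu : IsPauliBasis Γ u c) {g₁ g₂ g₃ g₄ : k × k}
    (hA : QuarticAdmissible Γ g₁ g₂ g₃ g₄) (r : K) :
    quarticPoly r g₁ g₂ g₃ g₄ ∈ gradedIdentities Γ ↔ r = quarticScalar c g₁ g₂ g₃ g₄ := by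
  obtain ⟨hA', hA⟩ := hu.quarticAdmissible_iff.mp hA
  have hne := hu.ne_zero (add_ne_zero_of_sympForm
    (hu.coeff_ne_zero.mp (right_ne_zero_of_mul hA')))
  have hev : ∀ t, scaledEval u t (quarticPoly r g₁ g₂ g₃ g₄) =
      (t (g₁, 1) * t (g₂, 2) * t (g₃, 3) * t (g₄, 4) *
      (c g₄ g₁ * c (g₄ + g₁) g₂ * c (g₄ + g₁ + g₂) g₃ -
        r * (c g₄ g₃ * c (g₄ + g₃) g₂ * c (g₄ + g₃ + g₂) g₁))) • u (g₄ + g₁ + g₂ + g₃) := by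
    intro t
    have hs : g₄ + g₃ + g₂ + g₁ = g₄ + g₁ + g₂ + g₃ := by abel
    rw [quarticPoly, map_sub, map_smul, hu.scaledEval_comm4, hu.scaledEval_comm4, hs, smul_smul,
      ← sub_smul]
    congr 1
    ring
  rw [hu.mem_gradedIdentities, quarticScalar, eq_div_iff hA]
  constructor
  · intro H
    have h1 := H 1
    rw [hev] at h1
    simp only [Pi.one_apply, mul_one, one_mul, smul_eq_zero, hne, or_false] at h1
    exact (sub_eq_zero.mp h1).symm
  · intro H t
    rw [hev, H, sub_self, mul_zero, zero_smul]

theorem quarticScalar_ne_zero (hu : IsPauliBasis Γ u c) {g₁ g₂ g₃ g₄ : k × k}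
    (hA : QuarticAdmissible Γ g₁ g₂ g₃ g₄) : quarticScalar c g₁ g₂ g₃ g₄ ≠ 0 :=
  div_ne_zero (hu.quarticAdmissible_iff.mp hA).1 (hu.quarticAdmissible_iff.mp hA).2

end IsPauliBasis

/-- The set of polynomials that is shown to be a basis of the graded identities. -/
def identityBasis (Γ : k × k → Submodule K L) (c : k × k → k × k → K) :
    Set (FreeGradedLie K (k × k)) :=
  basisOne Γ ∪ basisTwo Γ ∪ basisThree Γ (cubicScalar c) ∪ basisFour Γ (quarticScalar c)

namespace IsPauliBasis

variable {Γ : k × k → Submodule K L} {u : k × k → L} {c : k × k → k × k → K}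

theorem identityBasis_subset (hu : IsPauliBasis Γ u c) :
    identityBasis Γ c ⊆ gradedIdentities Γ := by
  rintro f (((⟨g, hg, rfl⟩ | ⟨g, h, hC, -, rfl⟩) | ⟨g, h, l, hA, rfl⟩) | ⟨g₁, g₂, g₃, g₄, hA, rfl⟩)
  · intro a ha
    have h1 : Γ g = ⊥ := not_not.mp hg
    have h2 := ha g 1
    rw [h1, Submodule.mem_bot] at h2
    rw [gvar, FreeLieAlgebra.lift_of_apply, h2]
  · intro a ha
    rw [LieHom.map_lie, gvar, gvar, FreeLieAlgebra.lift_of_apply, FreeLieAlgebra.lift_of_apply]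
    exact hC _ (ha g 1) _ (ha h 2)
  · exact (hu.cubicPoly_mem_iff hA _).mpr rfl
  · exact (hu.quarticPoly_mem_iff hA _).mpr rfl

theorem tIdealSpan_subset (hu : IsPauliBasis Γ u c) :
    (tIdealSpan (identityBasis Γ c) : Set (FreeGradedLie K (k × k))) ⊆ gradedIdentities Γ :=
  tIdealSpan_le (I := gradedIdentityIdeal Γ) (isTIdeal_gradedIdentityIdeal hu.lie_mem)
    hu.identityBasis_subset

variable {I : LieIdeal K (FreeGradedLie K (k × k))}

theorem mem_of_mem_freeComponent_zero (hu : IsPauliBasis Γ u c) (hI : IsTIdeal I)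
    (hS : identityBasis Γ c ⊆ (I : Set (FreeGradedLie K (k × k)))) {x : FreeGradedLie K (k × k)}
    (hx : x ∈ freeComponent K 0) : x ∈ I := by
  apply hI.mem_of_gvar hx
  apply hS
  exact Or.inl (Or.inl (Or.inl ⟨0, by rw [hu.mem_gradingSupport]; simp, rfl⟩))

/-- Family 2 covers `g + h ≠ 0`; for `g + h = 0` the bracket has degree outside the support and
family 1 applies. -/
theorem lie_mem_of_coeff_eq_zero (hu : IsPauliBasis Γ u c) (hI : IsTIdeal I)
    (hS : identityBasis Γ c ⊆ (I : Set (FreeGradedLie K (k × k)))) {g h : k × k}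
    {x y : FreeGradedLie K (k × k)} (hx : x ∈ freeComponent K g) (hy : y ∈ freeComponent K h)
    (hgh : c g h = 0) : ⁅x, y⁆ ∈ I := by
  by_cases h0 : g + h = 0
  · apply hu.mem_of_mem_freeComponent_zero hI hS
    rw [← h0]
    exact lie_mem_freeComponent hx hy
  · apply hI.lie_mem_of_gvar hx hy
    apply hS
    exact Or.inl (Or.inl (Or.inr ⟨g, h, hu.mem_gradingCentralizer hgh,
      hu.mem_gradingSupport.mpr h0, rfl⟩))

/-- The homogeneous elements of the quotient by a graded ideal, with their degrees. They are
multiplied with a normalization by the structure constants `c`. -/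

def Homogeneous (_ : k × k → k × k → K) (I : LieIdeal K (FreeGradedLie K (k × k))) : Type _ :=
  {p : (k × k) × (FreeGradedLie K (k × k) ⧸ I) // ∃ x ∈ freeComponent K p.1,
    LieSubmodule.Quotient.mk' I x = p.2}

/-- The degree of a homogeneous element. -/
def Homogeneous.deg (v : Homogeneous c I) : k × k := v.1.1

/-- The underlying element of a homogeneous element. -/
def Homogeneous.val (v : Homogeneous c I) : FreeGradedLie K (k × k) ⧸ I := v.1.2

theorem Homogeneous.exists_rep (v : Homogeneous c I) : ∃ x ∈ freeComponent K v.deg,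
    LieSubmodule.Quotient.mk' I x = v.val := v.2

theorem mk'_lie {I : LieIdeal K L} (x y : L) : LieSubmodule.Quotient.mk' I ⁅x, y⁆ =
    ⁅LieSubmodule.Quotient.mk' I x, LieSubmodule.Quotient.mk' I y⁆ := rfl

theorem Homogeneous.ext {v w : Homogeneous c I} (h₁ : v.deg = w.deg) (h₂ : v.val = w.val) : v = w :=
  Subtype.ext (Prod.ext h₁ h₂)

/-- The product of homogeneous elements of degrees `g`, `h`, normalized by `c(g, h)`. -/
noncomputable instance : Mul (Homogeneous c I) where
  mul v w := ⟨(v.deg + w.deg, (c v.deg w.deg)⁻¹ • ⁅v.val, w.val⁆), by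
    obtain ⟨x, hx, hx'⟩ := v.exists_rep
    obtain ⟨y, hy, hy'⟩ := w.exists_rep
    refine ⟨(c v.deg w.deg)⁻¹ • ⁅x, y⁆,
      Submodule.smul_mem _ _ (lie_mem_freeComponent hx hy), ?_⟩
    rw [map_smul, mk'_lie, hx', hy']⟩

theorem Homogeneous.deg_mul (v w : Homogeneous c I) : (v * w).deg = v.deg + w.deg := rfl

theorem Homogeneous.val_mul (v w : Homogeneous c I) :
    (v * w).val = (c v.deg w.deg)⁻¹ • ⁅v.val, w.val⁆ := rfl

/-- The factors `c(g, h)⁻¹` make the skew bracket commutative, as `c` is skew too, and they cancel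
the scalars `λ` in families 3 and 4. -/
theorem isSympMagma (hu : IsPauliBasis Γ u c) (hI : IsTIdeal I)
    (hS : identityBasis Γ c ⊆ (I : Set (FreeGradedLie K (k × k)))) :
    IsSympMagma (Homogeneous.deg : Homogeneous c I → k × k) := by
  refine ⟨?_, Homogeneous.deg_mul, ?_, ?_⟩
  · intro v w
    refine Homogeneous.ext (by rw [Homogeneous.deg_mul, Homogeneous.deg_mul, add_comm]) ?_
    rw [Homogeneous.val_mul, Homogeneous.val_mul, hu.swap v.deg w.deg, ← lie_skew, inv_neg, neg_smul, smul_neg]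
  · intro x y z hxy hxyz hxz hxzy
    refine Homogeneous.ext (by simp only [Homogeneous.deg_mul, add_right_comm]) ?_
    simp only [Homogeneous.val_mul, Homogeneous.deg_mul, smul_lie, smul_smul]
    rw [← hu.coeff_ne_zero] at hxy hxyz hxz hxzy
    obtain ⟨x', hx, hx'⟩ := x.exists_rep
    obtain ⟨y', hy, hy'⟩ := y.exists_rep
    obtain ⟨z', hz, hz'⟩ := z.exists_rep
    have key := hI.cubic_mem hx hy hz (c := cubicScalar c x.deg y.deg z.deg)
      (hS (Or.inl (Or.inr ⟨_, _, _, hu.cubicAdmissible_iff.mpr (mul_ne_zero hxy hxyz), rfl⟩)))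
    have key' := sub_eq_zero.mp ((map_sub (LieSubmodule.Quotient.mk' I) _ _).symm.trans
      ((LieSubmodule.Quotient.mk_eq_zero _).mpr key))
    simp only [map_smul, mk'_lie, hx', hy', hz'] at key'
    rw [key', smul_smul]
    congr 1
    rw [cubicScalar]
    field_simp
  · intro w x y z hwx hwxy hwxyz hwz hwzy hwzyx
    refine Homogeneous.ext (by simp only [Homogeneous.deg_mul]; abel) ?_
    simp only [Homogeneous.val_mul, Homogeneous.deg_mul, smul_lie, smul_smul]
    rw [← hu.coeff_ne_zero] at hwx hwxy hwxyz hwz hwzy hwzyx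
    obtain ⟨x', hx, hx'⟩ := x.exists_rep
    obtain ⟨y', hy, hy'⟩ := y.exists_rep
    obtain ⟨z', hz, hz'⟩ := z.exists_rep
    obtain ⟨w', hw, hw'⟩ := w.exists_rep
    have key := hI.quartic_mem hx hy hz hw (c := quarticScalar c x.deg y.deg z.deg w.deg)
      (hS (Or.inr ⟨_, _, _, _, hu.quarticAdmissible_iff.mpr
        ⟨mul_ne_zero (mul_ne_zero hwx hwxy) hwxyz, mul_ne_zero (mul_ne_zero hwz hwzy) hwzyx⟩, rfl⟩))
    have key' := sub_eq_zero.mp ((map_sub (LieSubmodule.Quotient.mk' I) _ _).symm.trans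
      ((LieSubmodule.Quotient.mk_eq_zero _).mpr key))
    simp only [map_smul, mk'_lie, hx', hy', hz', hw'] at key'
    rw [key', smul_smul]
    congr 1
    rw [quarticScalar]
    field_simp

end IsPauliBasis

end PauliBasis

/-! ### Every graded identity lies in the ideal. -/

section Completeness

variable {K : Type*} [Field K] {k : Type*} [Field k] {L : Type*} [LieRing L] [LieAlgebra K L]

namespace IsPauliBasis

variable {Γ : k × k → Submodule K L} {u : k × k → L} {c : k × k → k × k → K}
  {I : LieIdeal K (FreeGradedLie K (k × k))}

/-- The class of a variable as a homogeneous element. -/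
noncomputable def homogeneousVar (c : k × k → k × k → K) (I : LieIdeal K (FreeGradedLie K (k × k)))
    (x : (k × k) × ℕ) : Homogeneous c I :=
  ⟨(x.1, LieSubmodule.Quotient.mk' I (gvar K x.2 x.1)), _, gvar_mem_freeComponent _ _, rfl⟩

open Classical in
/-- The normalized value of all nonzero monomials in the variables `μ`, or zero if there are none. -/
noncomputable def normalForm (c : k × k → k × k → K) (I : LieIdeal K (FreeGradedLie K (k × k)))
    (μ : Multiset ((k × k) × ℕ)) : FreeGradedLie K (k × k) ⧸ I :=
  if h : ∃ v, MergesTo Homogeneous.deg (μ.map (homogeneousVar c I)) v then h.choose.val else 0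

theorem normalForm_eq (hu : IsPauliBasis Γ u c) (hI : IsTIdeal I)
    (hS : identityBasis Γ c ⊆ (I : Set (FreeGradedLie K (k × k)))) {μ : Multiset ((k × k) × ℕ)}
    {v : Homogeneous c I} (hv : MergesTo Homogeneous.deg (μ.map (homogeneousVar c I)) v) :
    normalForm c I μ = v.val := by
  have h : ∃ v, MergesTo Homogeneous.deg (μ.map (homogeneousVar c I)) v := ⟨v, hv⟩
  rw [normalForm, dif_pos h]
  congr 1
  exact mergeResults_subsingleton (hu.isSympMagma hI hS) _ h.choose_spec hv

theorem normalForm_eq_zero (hu : IsPauliBasis Γ u c) (hI : IsTIdeal I)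
    (hS : identityBasis Γ c ⊆ (I : Set (FreeGradedLie K (k × k)))) {μ : Multiset ((k × k) × ℕ)}
    (h0 : (μ.map Prod.fst).sum = 0) : normalForm c I μ = 0 := by
  by_cases h : ∃ v, MergesTo Homogeneous.deg (μ.map (homogeneousVar c I)) v
  · obtain ⟨v, hv⟩ := h
    rw [hu.normalForm_eq hI hS hv]
    have hdeg := hv.deg_eq (hu.isSympMagma hI hS)
    rw [Multiset.map_map] at hdeg
    obtain ⟨x, hx, hx'⟩ := v.exists_rep
    rw [← hx']
    apply (LieSubmodule.Quotient.mk_eq_zero _).mpr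
    apply hu.mem_of_mem_freeComponent_zero hI hS
    have h1 : v.deg = 0 := hdeg.trans h0
    rwa [h1] at hx
  · rw [normalForm, dif_neg h]

/-- The scalar `r` is the product of the structure constants met along the bracketing. The same `r`
governs the class of `f` modulo `I` and its values in `L`, and if `r ≠ 0` then all products were
admissible. -/
theorem exists_of_isGradedMonomial (hu : IsPauliBasis Γ u c) (hI : IsTIdeal I)
    (hS : identityBasis Γ c ⊆ (I : Set (FreeGradedLie K (k × k)))) {f : FreeGradedLie K (k × k)}
    {g : k × k} (hf : IsGradedMonomial f g) :
    ∃ (μ : Multiset ((k × k) × ℕ)) (r : K) (v : Homogeneous c I), v.deg = g ∧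
      (μ.map Prod.fst).sum = g ∧ LieSubmodule.Quotient.mk' I f = r • v.val ∧
      (r ≠ 0 → MergesTo Homogeneous.deg (μ.map (homogeneousVar c I)) v) ∧
      ∀ t, scaledEval u t f = (r * (μ.map t).prod) • u g := by
  induction hf with
  | var i g =>
    refine ⟨{(g, i)}, 1, homogeneousVar c I (g, i), rfl, by simp, ?_, fun _ => ?_, fun t => ?_⟩
    · rw [one_smul]; rfl
    · rw [Multiset.map_singleton]; exact .single _
    · rw [scaledEval_gvar]; simp
  | @bracket a b g h ha hb iha ihb =>
    obtain ⟨μ, r, v, hv, hμ, hr, hm, ht⟩ := iha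
    obtain ⟨ν, s, w, hw, hν, hs, hn, ht'⟩ := ihb
    refine ⟨μ + ν, r * s * c g h, v * w, ?_, ?_, ?_, fun hne => ?_, fun t => ?_⟩
    · rw [Homogeneous.deg_mul, hv, hw]
    · rw [Multiset.map_add, Multiset.sum_add, hμ, hν]
    · by_cases hc : c g h = 0
      · rw [hc, mul_zero, zero_smul]
        exact (LieSubmodule.Quotient.mk_eq_zero _).mpr (hu.lie_mem_of_coeff_eq_zero hI hS
          (Submodule.subset_span ha) (Submodule.subset_span hb) hc)
      · rw [mk'_lie, hr, hs, smul_lie, lie_smul, Homogeneous.val_mul, hv, hw, smul_smul, smul_smul,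
          mul_assoc (r * s), mul_inv_cancel₀ hc, mul_one]
    · rw [Multiset.map_add]
      refine (hm ?_).mul (hn ?_) ?_
      · rintro rfl; simp at hne
      · rintro rfl; simp at hne
      · rw [hv, hw]
        exact hu.coeff_ne_zero.mp (right_ne_zero_of_mul hne)
    · rw [LieHom.map_lie, ht, ht', hu.lie_smul_smul, Multiset.map_add, Multiset.prod_add]
      congr 1
      ring

/-- The linear map that replaces monomials by the normal forms. -/
noncomputable def normalFormMap (c : k × k → k × k → K)
    (I : LieIdeal K (FreeGradedLie K (k × k))) :
    MvPolynomial ((k × k) × ℕ) K →ₗ[K] FreeGradedLie K (k × k) ⧸ I :=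
  (MvPolynomial.basisMonomials _ K).constr K fun s => normalForm c I s.toMultiset

/-- The linear map that sends a monomial `m` of degree `g` to `m(t) u_g`. -/
noncomputable def degreeEval (u : k × k → L) (t : (k × k) × ℕ → K) :
    MvPolynomial ((k × k) × ℕ) K →ₗ[K] L :=
  (MvPolynomial.basisMonomials _ K).constr K fun s =>
    (s.toMultiset.map t).prod • u (s.toMultiset.map Prod.fst).sum

open Classical in
/-- The projection onto the polynomials of degree `g`. -/
noncomputable def degreePart (K : Type*) [Field K] (g : k × k) :
    MvPolynomial ((k × k) × ℕ) K →ₗ[K] MvPolynomial ((k × k) × ℕ) K :=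
  (MvPolynomial.basisMonomials _ K).constr K fun s =>
    if (s.toMultiset.map Prod.fst).sum = g then MvPolynomial.monomial s 1 else 0

theorem exists_polynomial (hu : IsPauliBasis Γ u c) (hI : IsTIdeal I)
    (hS : identityBasis Γ c ⊆ (I : Set (FreeGradedLie K (k × k)))) (f : FreeGradedLie K (k × k)) :
    ∃ P : MvPolynomial ((k × k) × ℕ) K, LieSubmodule.Quotient.mk' I f = normalFormMap c I P ∧
      ∀ t, scaledEval u t f = degreeEval u t P := by
  classical
  have hf : f ∈ Submodule.span K {f : FreeGradedLie K (k × k) | ∃ g, IsGradedMonomial f g} := by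
    rw [span_isGradedMonomial]; trivial
  induction hf using Submodule.span_induction with
  | mem f hf =>
    obtain ⟨g, hg⟩ := hf
    obtain ⟨μ, r, v, hv, hμ, hr, hm, ht⟩ := hu.exists_of_isGradedMonomial hI hS hg
    refine ⟨r • MvPolynomial.basisMonomials _ K (Multiset.toFinsupp μ), ?_, fun t => ?_⟩
    · rw [map_smul, normalFormMap, Module.Basis.constr_basis, Multiset.toFinsupp_toMultiset, hr]
      by_cases h0 : r = 0
      · rw [h0, zero_smul, zero_smul]
      · rw [hu.normalForm_eq hI hS (hm h0)]
    · rw [map_smul, degreeEval, Module.Basis.constr_basis, Multiset.toFinsupp_toMultiset, ht, hμ,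
        smul_smul]
  | zero => exact ⟨0, by simp, by simp⟩
  | add f f' _ _ hf hf' =>
    obtain ⟨P, hP, hP'⟩ := hf
    obtain ⟨Q, hQ, hQ'⟩ := hf'
    exact ⟨P + Q, by rw [map_add, map_add, hP, hQ], fun t => by rw [map_add, map_add, hP', hQ']⟩
  | smul r f _ hf =>
    obtain ⟨P, hP, hP'⟩ := hf
    exact ⟨r • P, by rw [map_smul, map_smul, hP], fun t => by rw [map_smul, map_smul, hP']⟩

/-- The form `τ` turns vanishing in `L` into vanishing of a scalar polynomial function. Both sides
are linear in `P`, so monomials suffice. -/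
theorem eval_degreePart {τ : L →ₗ[K] K} {g : k × k} (hτ : ∀ h, h ≠ g → τ (u h) = 0)
    (t : (k × k) × ℕ → K) (P : MvPolynomial ((k × k) × ℕ) K) :
    MvPolynomial.eval t (degreePart K g P) * τ (u g) = τ (degreeEval u t P) := by
  have h : (LinearMap.mulRight K (τ (u g))).comp
      ((MvPolynomial.aeval t).toLinearMap.comp (degreePart K g)) = τ.comp (degreeEval u t) := by
    apply (MvPolynomial.basisMonomials _ K).ext
    intro s
    simp only [LinearMap.comp_apply, degreePart, degreeEval, Module.Basis.constr_basis, map_smul]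
    split_ifs with hs
    · rw [hs]
      simp [MvPolynomial.aeval_monomial, Finsupp.toMultiset_map,
        Finsupp.prod_toMultiset, Finsupp.prod_mapDomain_index, pow_add]
    · rw [hτ _ hs]
      simp
  have := congrArg (fun e => e P) h
  simpa [MvPolynomial.aeval_eq_eval] using this

theorem coeff_degreePart (s : (k × k) × ℕ →₀ ℕ) (P : MvPolynomial ((k × k) × ℕ) K) :
    MvPolynomial.coeff s (degreePart K (s.toMultiset.map Prod.fst).sum P) =
      MvPolynomial.coeff s P := by
  classical
  have h : (MvPolynomial.lcoeff K s).comp (degreePart K (s.toMultiset.map Prod.fst).sum) =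
      MvPolynomial.lcoeff K s := by
    apply (MvPolynomial.basisMonomials _ K).ext
    intro s'
    simp only [LinearMap.comp_apply, degreePart, Module.Basis.constr_basis]
    simp only [MvPolynomial.coe_basisMonomials]
    split_ifs with hs
    · rfl
    · have hne : s' ≠ s := fun h => hs (by rw [h])
      simp [MvPolynomial.lcoeff_apply, MvPolynomial.coeff_monomial, hne]
  exact congrArg (fun e => e P) h

theorem subset_of_isTIdeal [Infinite K] (hu : IsPauliBasis Γ u c) (hI : IsTIdeal I)
    (hS : identityBasis Γ c ⊆ (I : Set (FreeGradedLie K (k × k)))) :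
    gradedIdentities Γ ⊆ (I : Set (FreeGradedLie K (k × k))) := by
  intro f hf
  obtain ⟨P, hP, hP'⟩ := hu.exists_polynomial hI hS f
  apply (LieSubmodule.Quotient.mk_eq_zero _).mp
  rw [hP, normalFormMap, Module.Basis.constr_apply]
  apply Finset.sum_eq_zero
  intro s _
  dsimp only
  by_cases hs : (s.toMultiset.map Prod.fst).sum = 0
  · rw [hu.normalForm_eq_zero hI hS hs, smul_zero]
  · obtain ⟨τ, hτ, hτ'⟩ := hu.exists_dual _ hs
    have h0 : degreePart K (s.toMultiset.map Prod.fst).sum P = 0 := by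
      -- A polynomial over an infinite field that vanishes at all points is zero.
      apply MvPolynomial.funext
      intro t
      apply mul_right_cancel₀ hτ
      rw [eval_degreePart hτ', ← hP' t, hu.mem_gradedIdentities.mp hf t]
      simp
    have hc : (MvPolynomial.basisMonomials _ K).repr P s = 0 := by
      change MvPolynomial.coeff s P = 0
      rw [← coeff_degreePart, h0, MvPolynomial.coeff_zero]
    rw [hc, zero_smul]

theorem tIdealSpan_eq [Infinite K] (hu : IsPauliBasis Γ u c) :
    (tIdealSpan (identityBasis Γ c) : Set (FreeGradedLie K (k × k))) = gradedIdentities Γ := by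
  apply Set.Subset.antisymm hu.tIdealSpan_subset
  intro f hf
  rw [tIdealSpan, LieSubmodule.coe_sInf, Set.mem_iInter₂]
  rintro I ⟨hI, hS⟩
  exact hu.subset_of_isTIdeal hI hS hf

end IsPauliBasis

end Completeness

/-! ### The Pauli matrices satisfy the axioms. -/

section PauliMatrices

variable {K : Type*} [Field K] {q : ℕ} {ε : K}

theorem pauliA_pow_eq_one (hε : ε ^ q = 1) : pauliA q ε ^ q = 1 := by
  rw [pauliA, Matrix.diagonal_pow, ← Matrix.diagonal_one]
  congr 1
  funext i
  rw [Pi.pow_apply, ← pow_mul, mul_comm, pow_mul, hε, one_pow]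

theorem pauliB_pow_apply [NeZero q] (n : ℕ) (i j : Fin q) :
    (pauliB q ^ n : Matrix (Fin q) (Fin q) K) i j = if (j : ℕ) = (i + n) % q then 1 else 0 := by
  induction n generalizing j with
  | zero =>
    rw [pow_zero, Matrix.one_apply, add_zero, Nat.mod_eq_of_lt i.2]
    simp [Fin.ext_iff, eq_comm]
  | succ n ih =>
    rw [pow_succ, Matrix.mul_apply]
    simp only [ih]
    have hlt : ((i : ℕ) + n) % q < q := Nat.mod_lt _ (Nat.pos_of_neZero q)
    rw [Finset.sum_eq_single (⟨((i : ℕ) + n) % q, hlt⟩ : Fin q)]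
    · simp [pauliB, add_assoc]
    · intro b _ hb
      rw [if_neg, zero_mul]
      intro h
      exact hb (Fin.ext h)
    · simp

theorem pauliB_pow_eq_one [NeZero q] : (pauliB q ^ q : Matrix (Fin q) (Fin q) K) = 1 := by
  ext i j
  rw [pauliB_pow_apply, Matrix.one_apply, Nat.add_mod_right, Nat.mod_eq_of_lt i.2]
  simp [Fin.ext_iff, eq_comm]

theorem pauliA_mul_pauliB [NeZero q] (hε : ε ^ q = 1) :
    pauliA q ε * pauliB q = ε • (pauliB q * pauliA q ε) := by
  ext i j
  rw [Matrix.smul_apply, pauliA, Matrix.diagonal_mul, Matrix.mul_diagonal, pauliB, Matrix.of_apply]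
  split_ifs with h
  · rw [mul_one, one_mul, smul_eq_mul, ← pow_succ', h]
    have hi := i.2
    by_cases hlt : (i : ℕ) + 1 < q
    · rw [Nat.mod_eq_of_lt hlt]
      congr 1
      omega
    -- In the wrap-around row the two sides are `1` and `ε ^ q`.
    · have : (i : ℕ) + 1 = q := by omega
      rw [this, Nat.mod_self]
      have h1 : q - 1 - (i : ℕ) = 0 := by omega
      have h2 : q - 1 - 0 + 1 = q := by omega
      rw [h1, h2, pow_zero, hε]
  · simp

variable (ε) in
/-- The matrix `A^i B^j`. -/
noncomputable def pauliMatrix (g : ZMod q × ZMod q) : Matrix (Fin q) (Fin q) K :=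
  pauliA q ε ^ g.1.val * pauliB q ^ g.2.val

variable (ε) in
/-- The character `a ↦ ε^{-a}` of `ℤ_q`. -/
noncomputable def pauliCharacter (a : ZMod q) : K := ε⁻¹ ^ a.val

theorem pauliMatrix_zero : pauliMatrix ε (0 : ZMod q × ZMod q) = 1 := by
  simp [pauliMatrix]

variable (ε) in
/-- The structure constants of the Pauli matrices. -/
noncomputable def pauliCoeff (g h : ZMod q × ZMod q) : K :=
  pauliCharacter ε (g.2 * h.1) - pauliCharacter ε (h.2 * g.1)

theorem pauliCoeff_swap (g h : ZMod q × ZMod q) : pauliCoeff ε h g = -pauliCoeff ε g h := by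
  rw [pauliCoeff, pauliCoeff, neg_sub]

theorem pow_mod_eq {M : Type*} [Monoid M] {x : M} (hx : x ^ q = 1) (n : ℕ) :
    x ^ (n % q) = x ^ n := by
  conv_rhs => rw [← Nat.div_add_mod n q, pow_add, pow_mul, hx, one_pow, one_mul]

theorem pauliB_pow_mul_pauliA_pow [NeZero q] (hε : ε ^ q = 1) (m n : ℕ) :
    pauliB q ^ m * pauliA q ε ^ n = ε⁻¹ ^ (m * n) • (pauliA q ε ^ n * pauliB q ^ m) := by
  have hε0 : ε ≠ 0 := by
    rintro rfl
    rw [zero_pow (NeZero.ne q)] at hε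
    exact zero_ne_one hε
  have h1 : pauliB q * pauliA q ε = ε⁻¹ • (pauliA q ε * pauliB q) := by
    rw [pauliA_mul_pauliB hε, smul_smul, inv_mul_cancel₀ hε0, one_smul]
  have h2 : ∀ m, pauliB q ^ m * pauliA q ε = ε⁻¹ ^ m • (pauliA q ε * pauliB q ^ m) := by
    intro m
    induction m with
    | zero => simp
    | succ m ih =>
      rw [pow_succ, mul_assoc, h1, mul_smul_comm, ← mul_assoc, ih, smul_mul_assoc, smul_smul,
        mul_assoc, ← pow_succ, ← pow_succ']
  induction n with
  | zero => simp
  | succ n ih =>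
    rw [pow_succ, ← mul_assoc, ih, smul_mul_assoc, mul_assoc, h2, mul_smul_comm, smul_smul,
      ← mul_assoc, ← pow_succ, ← pow_add, mul_add, mul_one]

variable [NeZero q]

theorem pauliMatrix_mul (hε : ε ^ q = 1) (g h : ZMod q × ZMod q) :
    pauliMatrix ε g * pauliMatrix ε h =
      pauliCharacter ε (g.2 * h.1) • pauliMatrix ε (g + h) := by
  rw [pauliMatrix, pauliMatrix, pauliMatrix, pauliCharacter, Prod.fst_add, Prod.snd_add,
    ZMod.val_add, ZMod.val_add, ZMod.val_mul, pow_mod_eq (pauliA_pow_eq_one hε),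
    pow_mod_eq pauliB_pow_eq_one, pow_mod_eq (by rw [inv_pow, hε, inv_one]),
    mul_assoc, ← mul_assoc (pauliB q ^ _), pauliB_pow_mul_pauliA_pow hε, smul_mul_assoc,
    mul_smul_comm, pow_add, pow_add]
  simp only [mul_assoc]

theorem pauliCharacter_injective (hε : IsPrimitiveRoot ε q) :
    Function.Injective (pauliCharacter ε : ZMod q → K) := by
  intro a b h
  exact ZMod.val_injective q (hε.inv.pow_inj (ZMod.val_lt a) (ZMod.val_lt b) h)

theorem pauliCharacter_ne_zero (hε : IsPrimitiveRoot ε q) (a : ZMod q) :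
    pauliCharacter ε a ≠ 0 :=
  pow_ne_zero _ (inv_ne_zero (hε.ne_zero (NeZero.ne q)))

theorem pauliMatrix_lie (hε : ε ^ q = 1) (g h : ZMod q × ZMod q) :
    ⁅pauliMatrix ε g, pauliMatrix ε h⁆ = pauliCoeff ε g h • pauliMatrix ε (g + h) := by
  rw [Ring.lie_def, pauliMatrix_mul hε, pauliMatrix_mul hε, add_comm h g, pauliCoeff, sub_smul]

theorem pauliCoeff_eq_zero_iff (hε : IsPrimitiveRoot ε q) (g h : ZMod q × ZMod q) :
    pauliCoeff ε g h = 0 ↔ g.1 * h.2 - g.2 * h.1 = 0 := by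
  rw [pauliCoeff, sub_eq_zero, (pauliCharacter_injective hε).eq_iff, sub_eq_zero, mul_comm h.2,
    eq_comm]

/-- The matrix is a nonzero multiple of the commutator of two Pauli matrices. -/
theorem trace_pauliMatrix_mul_eq_zero (hε : IsPrimitiveRoot ε q) {g h : ZMod q × ZMod q}
    (hgh : pauliCoeff ε g h ≠ 0) : (pauliMatrix ε (g + h)).trace = 0 := by
  have h1 : (⁅pauliMatrix ε g, pauliMatrix ε h⁆ : Matrix (Fin q) (Fin q) K).trace = 0 := by
    rw [Ring.lie_def, Matrix.trace_sub, Matrix.trace_mul_comm, sub_self]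
  rw [pauliMatrix_lie hε.pow_eq_one, Matrix.trace_smul, smul_eq_mul] at h1
  exact (mul_eq_zero.mp h1).resolve_left hgh

theorem trace_pauliMatrix (hε : IsPrimitiveRoot ε q) {g : ZMod q × ZMod q} (hg : g ≠ 0) :
    (pauliMatrix ε g).trace = 0 := by
  -- Write `g` as a sum of two independent vectors, one of them a standard basis vector independent
  -- of `g`.
  by_cases h1 : g.1 = 0
  · have h2 : g.2 ≠ 0 := fun h2 => hg (Prod.ext h1 h2)
    have := trace_pauliMatrix_mul_eq_zero hε (g := g - (1, 0)) (h := (1, 0))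
      (by rw [Ne, pauliCoeff_eq_zero_iff hε]; simpa using h2)
    rwa [sub_add_cancel] at this
  · have := trace_pauliMatrix_mul_eq_zero hε (g := g - (0, 1)) (h := (0, 1))
      (by rw [Ne, pauliCoeff_eq_zero_iff hε]; simpa using h1)
    rwa [sub_add_cancel] at this

/-- The element `A^i B^j` of `sl_q(K)` for `(i, j) ≠ (0, 0)`, and zero otherwise. -/
noncomputable def pauliElement (hε : IsPrimitiveRoot ε q) (g : ZMod q × ZMod q) :
    LieAlgebra.SpecialLinear.sl (Fin q) K :=
  if hg : g = 0 then 0 else ⟨pauliMatrix ε g, trace_pauliMatrix hε hg⟩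

theorem coe_pauliElement (hε : IsPrimitiveRoot ε q) {g : ZMod q × ZMod q} (hg : g ≠ 0) :
    (pauliElement hε g : Matrix (Fin q) (Fin q) K) = pauliMatrix ε g := by
  rw [pauliElement, dif_neg hg]

theorem pauliElement_zero (hε : IsPrimitiveRoot ε q) : pauliElement hε 0 = 0 := dif_pos rfl

theorem pauliComponent_eq (hε : IsPrimitiveRoot ε q) (g : ZMod q × ZMod q) :
    pauliComponent q ε g = Submodule.span K {pauliElement hε g} := by
  by_cases hg : g = 0
  · rw [hg, pauliElement_zero, pauliComponent, if_pos rfl, Submodule.span_zero_singleton]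
  · rw [pauliComponent, if_neg hg]
    ext x
    rw [Submodule.mem_comap, Submodule.mem_span_singleton, Submodule.mem_span_singleton]
    constructor
    · rintro ⟨r, hr⟩
      refine ⟨r, Subtype.ext ?_⟩
      exact (congrArg (r • ·) (coe_pauliElement hε hg)).trans hr
    · rintro ⟨r, rfl⟩
      exact ⟨r, (congrArg (r • ·) (coe_pauliElement hε hg)).symm⟩

theorem pauliElement_lie (hε : IsPrimitiveRoot ε q) (g h : ZMod q × ZMod q) :
    ⁅pauliElement hε g, pauliElement hε h⁆ = pauliCoeff ε g h • pauliElement hε (g + h) := by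
  by_cases hg : g = 0
  · have : pauliCoeff ε g h = 0 := by rw [pauliCoeff_eq_zero_iff hε, hg]; simp
    rw [this, hg, pauliElement_zero, zero_lie, zero_smul]
  by_cases hh : h = 0
  · have : pauliCoeff ε g h = 0 := by rw [pauliCoeff_eq_zero_iff hε, hh]; simp
    rw [this, hh, pauliElement_zero, lie_zero, zero_smul]
  apply Subtype.ext
  change ⁅(pauliElement hε g : Matrix (Fin q) (Fin q) K),
    (pauliElement hε h : Matrix (Fin q) (Fin q) K)⁆ =
      pauliCoeff ε g h • (pauliElement hε (g + h) : Matrix (Fin q) (Fin q) K)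
  rw [coe_pauliElement hε hg, coe_pauliElement hε hh, pauliMatrix_lie hε.pow_eq_one]
  by_cases hgh : g + h = 0
  · have : pauliCoeff ε g h = 0 := by
      rw [pauliCoeff_eq_zero_iff hε, eq_neg_of_add_eq_zero_right hgh, Prod.fst_neg, Prod.snd_neg]
      ring
    rw [this, zero_smul, zero_smul]
  · rw [coe_pauliElement hε hgh]

/-- The linear form `x ↦ tr(x A^{-i} B^{-j})`, where `g = (i, j)`. -/
noncomputable def pauliDual (ε : K) (g : ZMod q × ZMod q) :
    LieAlgebra.SpecialLinear.sl (Fin q) K →ₗ[K] K :=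
  (Matrix.traceLinearMap (Fin q) K K).comp
    ((LinearMap.mulRight K (pauliMatrix ε (-g))).comp
      (LieAlgebra.SpecialLinear.sl (Fin q) K).subtype)

theorem pauliDual_self (hε : IsPrimitiveRoot ε q) {g : ZMod q × ZMod q} (hg : g ≠ 0) :
    pauliDual ε g (pauliElement hε g) ≠ 0 := by
  have h1 : pauliDual ε g (pauliElement hε g) =
      (pauliMatrix ε g * pauliMatrix ε (-g)).trace := by
    rw [← coe_pauliElement hε hg]; rfl
  -- A primitive `q`-th root of unity forces `q ≠ 0` in `K`, so the identity matrix has nonzero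
  -- trace.
  have := hε.neZero'
  rw [h1, pauliMatrix_mul hε.pow_eq_one, add_neg_cancel, pauliMatrix_zero, Matrix.trace_smul,
    Matrix.trace_one, Fintype.card_fin, smul_eq_mul]
  exact mul_ne_zero (pauliCharacter_ne_zero hε _) (NeZero.ne _)

theorem pauliDual_of_ne (hε : IsPrimitiveRoot ε q) {g h : ZMod q × ZMod q} (hgh : h ≠ g) :
    pauliDual ε g (pauliElement hε h) = 0 := by
  by_cases hh : h = 0
  · rw [hh, pauliElement_zero, map_zero]
  have h1 : pauliDual ε g (pauliElement hε h) =
      (pauliMatrix ε h * pauliMatrix ε (-g)).trace := by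
    rw [← coe_pauliElement hε hh]; rfl
  rw [h1, pauliMatrix_mul hε.pow_eq_one, Matrix.trace_smul, ← sub_eq_add_neg,
    trace_pauliMatrix hε (sub_ne_zero.mpr hgh), smul_zero]

end PauliMatrices

/-- Primality of `q` enters here: it makes `ZMod q` a field, so that `G` is a plane. -/
theorem isPauliBasis_pauliElement {K : Type*} [Field K] {q : ℕ} [Fact q.Prime] {ε : K}
    (hε : IsPrimitiveRoot ε q) :
    IsPauliBasis (pauliComponent q ε) (pauliElement hε) (pauliCoeff ε) where
  span := pauliComponent_eq hε
  zero := pauliElement_zero hε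
  lie := pauliElement_lie hε
  swap := pauliCoeff_swap
  coeff_eq_zero := pauliCoeff_eq_zero_iff hε
  exists_dual g hg := ⟨pauliDual ε g, pauliDual_self hε hg, fun _ hh => pauliDual_of_ne hε hh⟩

theorem mainTheorem7 {K : Type*} [Field K] [Infinite K] (hK : ringChar K ≠ 2)
    (q : ℕ) (hq : q.Prime) (ε : K) (hε : IsPrimitiveRoot ε q) :
    ∃ (lam₃ : ZMod q × ZMod q → ZMod q × ZMod q → ZMod q × ZMod q → K)
      (lam₄ : ZMod q × ZMod q → ZMod q × ZMod q → ZMod q × ZMod q → ZMod q × ZMod q → K),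
      (∀ g h k, CubicAdmissible (pauliComponent q ε) g h k →
        ∀ c : K, cubicPoly c g h k ∈ gradedIdentities (pauliComponent q ε) ↔ c = lam₃ g h k) ∧
      (∀ g₁ g₂ g₃ g₄, QuarticAdmissible (pauliComponent q ε) g₁ g₂ g₃ g₄ →
        lam₄ g₁ g₂ g₃ g₄ ≠ 0 ∧
        ∀ c : K, quarticPoly c g₁ g₂ g₃ g₄ ∈ gradedIdentities (pauliComponent q ε) ↔
          c = lam₄ g₁ g₂ g₃ g₄) ∧
      (tIdealSpan (basisOne (pauliComponent q ε) ∪ basisTwo (pauliComponent q ε) ∪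
          basisThree (pauliComponent q ε) lam₃ ∪ basisFour (pauliComponent q ε) lam₄) :
            Set (FreeGradedLie K (ZMod q × ZMod q))) =
        gradedIdentities (pauliComponent q ε) := by
  have := Fact.mk hq
  have hu := isPauliBasis_pauliElement hε
  exact ⟨cubicScalar (pauliCoeff ε), quarticScalar (pauliCoeff ε),
    fun g h l hA r => hu.cubicPoly_mem_iff hA r,
    fun g₁ g₂ g₃ g₄ hA => ⟨hu.quarticScalar_ne_zero hA, fun r => hu.quarticPoly_mem_iff hA r⟩,
    hu.tIdealSpan_eq⟩
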